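/- **Theorem (Regret upper bound of DRAM).** *Model.* Let $\mathcal Y$ be a finite label set, $d=|\mathcal Y|$, and let there be $N\ge 2$ agents and $T\ge 2$ rounds. In each round, independently of the others, a true label $Y_t\sim p_Y$ is drawn and, given $Y_t=y$, the agents independently observe $X_{it}\sim p_i(\cdot\mid y)$; observing costs $c>0$. An agent may observe and report any function of her observation, or lazily report a label without observing (at no cost). A payment rule for agent $i$ in a round is *truthful* if, the other agents being honest, observing and reporting honestly maximizes her expected payment minus observation cost. In a round whose rules are truthful for all agents, all agents report their observations, $Z_{it}=X_{it}$; in the other rounds the reports $Z_{it}$ are arbitrary. *Mechanism design.* Agent $i$ has a reference agent $j=j(i)\ne i$, and belief matrix $\mathbf B_{(i)}=\big(\mathbb P(X_j=x'\mid X_i=x)\big)_{x,x'}$. For a law $p$ of $(X_i,X_j)$ and a margin $\delta$, the margin-$\delta$ problem is to minimize $\kappa$ over reward functions $R:\mathcal Y^2\to\mathbb R$ subject to $|R|\le\kappa$; $\mathbb E_p[R(x,X_j)\mid X_i=x]\ge c+\delta$ for all $x$; $\mathbb E_p[R(z,X_j)\mid X_i=x]\le c-\delta$ for all $z\neq x$;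 and $\mathbb E_p[R(z,X_j)]\le-\delta$ for all $z$. *Solving* it means taking an optimal $R$ that has the least expected payment $\mathbb E_p[R(X_i,X_j)]$ among the optimal ones. The *optimal payment* for agent $i$ is the infimum of $\mathbb E[R(X_i,X_j)]$ under the true law over all $R$ satisfying the last three constraints with $\delta=0$. *Algorithm DRAM.* Inputs: $\varepsilon\in(0,1)$; $\rho>0$ and $\gamma_{(i)}<1$ with $\rho\le\mathbb P(X_i=x)\le\gamma_{(i)}$ for all $i,x$; and $\tilde\eta>0$. Put $L=\log\big((d+1)2^dN\log T/\varepsilon\big)$, replace $\tilde\eta$ by $\min(\tilde\eta,1/\sqrt2)$, and let $\tau=\lceil L/(2\rho\tilde\eta^2)\rceil$. In the warm-start rounds $t\le\tau$ agent $i$ is paid $\mathbf 1\{Z_{it}=Y_t\}$. Let $\tau_0=\tau$ and $\tau_k-\tau_{k-1}=2^{k-1}\tau$. In epoch $k\ge1$, that is for $\tau_{k-1}<t\le\tau_k$, agent $i$ is paid $R_{ik}(Z_{it},Z_{jt})$, where $R_{ik}$ solves the margin-$\delta_{ik}$ problem for the empirical law of the reports $(Z_{is},Z_{js})_{s\le\tau_{k-1}}$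 (it is arbitrary if that problem has no solution). Here $\eta_k=\sqrt{L/(2\rho\tau_{k-1})}$ and $$\delta_{ik}=\frac{2\|\hat{\mathbf B}^{-1}\|_2(\gamma_{(i)}d+1)\,\eta_k}{(1-\gamma_{(i)})-2\|\hat{\mathbf B}^{-1}\|_2\big((1+\gamma_{(i)})d+2\big)\eta_k}\;c,$$ with $\hat{\mathbf B}$ the empirical belief matrix $\hat p_{ik}(x_j\mid x_i)$ and $\|\cdot\|_2$ the spectral norm. The algorithm is run for $T$ rounds. *Assumptions.* Every $\mathbf B_{(i)}$ is invertible, and $$\tilde\eta\le\frac12\min_i\frac{1-\gamma_{(i)}}{2\|\mathbf B_{(i)}^{-1}\|_2\big((1+\gamma_{(i)})d+2\big)}.$$ For the warm-start phase: $0<\underline p\le p_Y(y)\le\overline p$ for all $y$; $p_i(x\mid x)\ge\frac{\overline p}{\underline p}\,p_i(x\mid y)$ for all $i$ and $y\ne x$; and $\mathbb P(X_i=Y)-c\ge\max_y p_Y(y)$ for all $i$. *Conclusion.* There is a constant $C>0$ that depends only on $\mathcal Y,c,\rho,\tilde\eta$ (not on $N$, $T$, $\varepsilon$ or the rest of the instance)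 such that, with probability at least $1-\varepsilon$, both of the following hold: * in all $T$ rounds the deployed rules are truthful for all $N$ agents, and all agents report truthfully, $Z_{it}=X_{it}$; * the expected total regret, i.e. the sum over rounds and agents of the expected payment (for a fresh task under the true law, with honest reports) of the rule in force minus the optimal payment, is at most $$C\,N\sqrt T\,\log\!\big(N\log T/\varepsilon\big).$$ -/

import Mathlib

open MeasureTheory ProbabilityTheory

noncomputable section

namespace DRAM

/-! ### The labelling model -/

/-- One prediction task with label set `𝒴` and `N` agents: the true label has law `prior`, and given
the true label `y` the agents independently observe labels, agent `i` observing `x` with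
probability `skill i y x`. -/
structure Model (𝒴 : Type*) [Fintype 𝒴] (N : ℕ) where
  prior : 𝒴 → ℝ
  prior_nonneg : ∀ y, 0 ≤ prior y
  prior_sum : ∑ y, prior y = 1
  skill : Fin N → 𝒴 → 𝒴 → ℝ
  skill_nonneg : ∀ i y x, 0 ≤ skill i y x
  skill_sum : ∀ i y, ∑ x, skill i y x = 1

section Model

variable {𝒴 : Type*} [Fintype 𝒴] [DecidableEq 𝒴] {N : ℕ}

/-- Joint probability of the true label `y` and the observation profile `x`. -/
def Model.joint (M : Model 𝒴 N) (y : 𝒴) (x : Fin N → 𝒴) : ℝ :=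
  M.prior y * ∏ i, M.skill i y (x i)

/-- Expectation, over one task, of a function of the true label and the observation profile. -/
def Model.expect (M : Model 𝒴 N) (f : 𝒴 → (Fin N → 𝒴) → ℝ) : ℝ :=
  ∑ y, ∑ x : Fin N → 𝒴, M.joint y x * f y x

/-- `ℙ(Xᵢ = x)`. -/
def Model.obsProb (M : Model 𝒴 N) (i : Fin N) (x : 𝒴) : ℝ :=
  M.expect fun _ X => if X i = x then 1 else 0

/-- The belief matrix `ℙ(Xⱼ = x' ∣ Xᵢ = x)`. -/
def Model.belief (M : Model 𝒴 N) (i j : Fin N) : Matrix 𝒴 𝒴 ℝ :=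
  Matrix.of fun x x' =>
    (M.expect fun _ X => if X i = x ∧ X j = x' then 1 else 0) / M.obsProb i x

/-- The tasks `t = 0, 1, 2, …` are i.i.d. with the law given by `M`; `Y t` is the true label and
`X t` the observation profile of task `t`. -/
structure IsSample (M : Model 𝒴 N) [MeasurableSpace 𝒴] {Ω : Type*} [MeasurableSpace Ω]
    (P : Measure Ω) (Y : ℕ → Ω → 𝒴) (X : ℕ → Ω → Fin N → 𝒴) : Prop where
  measurable_label : ∀ t, Measurable (Y t)
  measurable_obs : ∀ t, Measurable (X t)
  law : ∀ t y x, P {ω | Y t ω = y ∧ X t ω = x} = ENNReal.ofReal (M.joint y x)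
  indep : iIndepFun (fun t ω => (Y t ω, X t ω)) P

/-! ### Incentives in one round -/

/-- A payment rule for one agent in one round: the payment as a function of the true label and of
the profile of reports. -/
abbrev PaymentRule (𝒴 : Type*) (N : ℕ) := 𝒴 → (Fin N → 𝒴) → ℝ

/-- Expected utility of agent `i` when she observes at cost `c` and reports `s x` on observing `x`,
all the other agents being honest. -/
def Model.workUtility (M : Model 𝒴 N) (c : ℝ) (i : Fin N) (r : PaymentRule 𝒴 N) (s : 𝒴 → 𝒴) : ℝ :=
  M.expect (fun y X => r y (Function.update X i (s (X i)))) - c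

/-- Expected utility of agent `i` when she lazily reports `z` without observing, all the other
agents being honest. -/
def Model.lazyUtility (M : Model 𝒴 N) (i : Fin N) (r : PaymentRule 𝒴 N) (z : 𝒴) : ℝ :=
  M.expect (fun y X => r y (Function.update X i z))

/-- Truthfulness of a rule for agent `i`: if all the others are honest, observing and reporting
honestly maximizes her expected utility. (A randomized strategy is a mixture of the strategies
below, and its utility is the corresponding average.) -/
def Model.Truthful (M : Model 𝒴 N) (c : ℝ) (i : Fin N) (r : PaymentRule 𝒴 N) : Prop :=
  (∀ s : 𝒴 → 𝒴, M.workUtility c i r s ≤ M.workUtility c i r id) ∧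
    ∀ z : 𝒴, M.lazyUtility i r z ≤ M.workUtility c i r id

/-! ### Two-agent mechanism design

A law of the pair (focal observation, reference observation) is given by the law `μ` of the focal
observation and by the belief matrix `B`. A mechanism is a reward matrix `R`, with `R z x'` the
payment to the focal agent when she reports `z` and the reference agent reports `x'`. -/

/-- Expected payment under honest reports. -/
def pairPayment (μ : 𝒴 → ℝ) (B R : Matrix 𝒴 𝒴 ℝ) : ℝ :=
  ∑ x, μ x * ∑ x', B x x' * R x x'

/-- Individual rationality, truthfulness and no free lunch, with cost `c` and safety margin `δ`.
The original problem, without margin, is the case `δ = 0`. -/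
structure MarginFeasible (μ : 𝒴 → ℝ) (B : Matrix 𝒴 𝒴 ℝ) (c δ : ℝ) (R : Matrix 𝒴 𝒴 ℝ) : Prop where
  rational : ∀ x, c + δ ≤ ∑ x', B x x' * R x x'
  no_lie : ∀ x z, z ≠ x → ∑ x', B x x' * R z x' ≤ c - δ
  no_free_lunch : ∀ z, ∑ x', (∑ x, μ x * B x x') * R z x' ≤ -δ

/-- Least expected payment in the original two-agent problem. -/
def optimalPayment (μ : 𝒴 → ℝ) (B : Matrix 𝒴 𝒴 ℝ) (c : ℝ) : ℝ :=
  sInf {p | ∃ R, MarginFeasible μ B c 0 R ∧ p = pairPayment μ B R}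

/-- `(κ, R)` is feasible for the margin-`δ` problem, whose objective is to minimize `κ`. -/
def RobustFeasible (μ : 𝒴 → ℝ) (B : Matrix 𝒴 𝒴 ℝ) (c δ κ : ℝ) (R : Matrix 𝒴 𝒴 ℝ) : Prop :=
  (∀ z x', |R z x'| ≤ κ) ∧ MarginFeasible μ B c δ R

/-- `R` is an optimal mechanism of the margin-`δ` problem, and has the least expected payment among
the optimal ones. -/
def IsRobustSolution (μ : 𝒴 → ℝ) (B : Matrix 𝒴 𝒴 ℝ) (c δ : ℝ) (R : Matrix 𝒴 𝒴 ℝ) : Prop :=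
  ∃ κ, RobustFeasible μ B c δ κ R ∧
    (∀ κ' R', RobustFeasible μ B c δ κ' R' → κ ≤ κ') ∧
    ∀ R', RobustFeasible μ B c δ κ R' → pairPayment μ B R ≤ pairPayment μ B R'

/-- `solve μ B δ` solves the margin-`δ` problem designed with `(μ, B)` whenever it has a solution. -/
def IsOracle (c : ℝ) (solve : (𝒴 → ℝ) → Matrix 𝒴 𝒴 ℝ → ℝ → Matrix 𝒴 𝒴 ℝ) : Prop :=
  ∀ μ B δ, (∃ R, IsRobustSolution μ B c δ R) → IsRobustSolution μ B c δ (solve μ B δ)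

/-- Spectral norm of a real square matrix. -/
def specNorm (A : Matrix 𝒴 𝒴 ℝ) : ℝ := ‖Matrix.toEuclideanCLM (n := 𝒴) (𝕜 := ℝ) A‖

/-- Ambiguity threshold of an agent with belief matrix `B` and largest observation probability at
most `γ`. -/
def agentThreshold (B : Matrix 𝒴 𝒴 ℝ) (γ : ℝ) : ℝ :=
  (1 - γ) / (2 * specNorm B⁻¹ * ((1 + γ) * Fintype.card 𝒴 + 2))

/-- Safety margin for a design belief matrix `B` and ambiguity level `η`. -/
def safetyMargin (B : Matrix 𝒴 𝒴 ℝ) (γ η c : ℝ) : ℝ :=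
  2 * specNorm B⁻¹ * (γ * Fintype.card 𝒴 + 1) * η /
    ((1 - γ) - 2 * specNorm B⁻¹ * ((1 + γ) * Fintype.card 𝒴 + 2) * η) * c

end Model

/-! ### The algorithm

Rounds are numbered from `0`, so that the first `n` rounds are the rounds `t < n`. A history
`h : ℕ → Fin N → 𝒴` lists the report profiles; a rule deployed in round `t` uses only `h s` with
`s < t`. -/

/-- Input of the algorithm. -/
structure Input (𝒴 : Type*) (N : ℕ) where
  /-- observation cost -/
  cost : ℝ
  /-- number of rounds -/
  horizon : ℕ
  /-- ambiguity threshold -/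
  threshold : ℝ
  /-- failure tolerance -/
  tol : ℝ
  /-- lower bound on the observation probabilities -/
  freq : ℝ
  /-- upper bounds on the observation probabilities of the agents -/
  maxFreq : Fin N → ℝ
  /-- the reference agents -/
  ref : Fin N → Fin N
  /-- the optimization oracle -/
  solve : (𝒴 → ℝ) → Matrix 𝒴 𝒴 ℝ → ℝ → Matrix 𝒴 𝒴 ℝ

section Algorithm

variable {𝒴 : Type*} [Fintype 𝒴] [DecidableEq 𝒴] {N : ℕ}

/-- `log ((d + 1) 2 ^ d N log T / ε)`. -/
def Input.logFactor (A : Input 𝒴 N) : ℝ :=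
  Real.log (((Fintype.card 𝒴 : ℝ) + 1) * 2 ^ Fintype.card 𝒴 * N * Real.log A.horizon / A.tol)

/-- Length `τ` of the warm-start phase. -/
def Input.warmLength (A : Input 𝒴 N) : ℕ :=
  ⌈A.logFactor / (2 * A.freq * (min A.threshold (1 / Real.sqrt 2)) ^ 2)⌉₊

/-- The epoch schedule `τ₀ = τ`, `τₖ₊₁ - τₖ = 2 ^ k τ`. -/
def Input.epochEnd (A : Input 𝒴 N) : ℕ → ℕ
  | 0 => A.warmLength
  | k + 1 => A.epochEnd k + 2 ^ k * A.warmLength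

/-- For a round `t` of the adaptive phase, the `k` with `τₖ ≤ t < τₖ₊₁`. -/
def Input.epochIndex (A : Input 𝒴 N) (t : ℕ) : ℕ :=
  Nat.findGreatest (fun k => A.epochEnd k ≤ t) t

/-- Ambiguity parameter in the epoch that begins after `τₖ` rounds. -/
def Input.ambiguity (A : Input 𝒴 N) (k : ℕ) : ℝ :=
  Real.sqrt (A.logFactor / (2 * A.freq * A.epochEnd k))

/-- Empirical law of the reports of agent `i` in the first `n` rounds. -/
def empiricalLaw (h : ℕ → Fin N → 𝒴) (n : ℕ) (i : Fin N) (x : 𝒴) : ℝ :=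
  ((Finset.range n).filter fun t => h t i = x).card / n

/-- Empirical conditional law of the reports of agent `j` given those of agent `i` in the first `n`
rounds. -/
def empiricalBelief (h : ℕ → Fin N → 𝒴) (n : ℕ) (i j : Fin N) : Matrix 𝒴 𝒴 ℝ :=
  Matrix.of fun x x' =>
    (((Finset.range n).filter fun t => h t i = x ∧ h t j = x').card : ℝ) /
      ((Finset.range n).filter fun t => h t i = x).card

/-- Mechanism computed for agent `i` at the beginning of the epoch that begins after `τₖ` rounds. -/
def Input.mechanism (A : Input 𝒴 N) (h : ℕ → Fin N → 𝒴) (k : ℕ) (i : Fin N) : Matrix 𝒴 𝒴 ℝ :=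
  let n := A.epochEnd k
  let B := empiricalBelief h n i (A.ref i)
  A.solve (empiricalLaw h n i) B (safetyMargin B (A.maxFreq i) (A.ambiguity k) A.cost)

/-- Payment rule of agent `i` in round `t`: fact checking in the warm-start phase, the mechanism of
the current epoch afterwards. -/
def Input.rule (A : Input 𝒴 N) (h : ℕ → Fin N → 𝒴) (t : ℕ) (i : Fin N) : PaymentRule 𝒴 N :=
  if t < A.warmLength then fun y z => if z i = y then 1 else 0
  else fun _ z => A.mechanism h (A.epochIndex t) i (z i) (z (A.ref i))

/-- The report process `Z` is that of rational agents who face the algorithm: in every round whose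
payment rules are truthful for all the agents, they all report their observations. In all the other
rounds the reports are arbitrary. -/
def Input.RationalReports (A : Input 𝒴 N) (M : Model 𝒴 N) {Ω : Type*}
    (X Z : ℕ → Ω → Fin N → 𝒴) : Prop :=
  ∀ ω, ∀ t < A.horizon,
    (∀ i, M.Truthful A.cost i (A.rule (fun s => Z s ω) t i)) → Z t ω = X t ω

/-- Expected total regret of the deployed rules: the sum over rounds and agents of the expected
payment, under the true law and honest reports, of the rule in force, minus the optimal expected
payment. -/
def Input.expectedRegret (A : Input 𝒴 N) (M : Model 𝒴 N) (h : ℕ → Fin N → 𝒴) : ℝ :=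
  ∑ t ∈ Finset.range A.horizon, ∑ i : Fin N,
    (M.expect (A.rule h t i) -
      optimalPayment (M.obsProb i) (M.belief i (A.ref i)) A.cost)

/-- Requirements on the input of the algorithm in the model `M`. -/
structure Input.Valid (A : Input 𝒴 N) (M : Model 𝒴 N) : Prop where
  tol_pos : 0 < A.tol
  tol_lt : A.tol < 1
  ref_ne : ∀ i, A.ref i ≠ i
  freq_le : ∀ i x, A.freq ≤ M.obsProb i x
  le_maxFreq : ∀ i x, M.obsProb i x ≤ A.maxFreq i
  maxFreq_lt : ∀ i, A.maxFreq i < 1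
  belief_invertible : ∀ i, IsUnit (M.belief i (A.ref i)).det
  threshold_le : ∀ i,
    A.threshold ≤ agentThreshold (M.belief i (A.ref i)) (A.maxFreq i) / 2
  oracle : IsOracle A.cost A.solve

/-- Conditions for the warm-start phase: diagonal dominance of the skills with respect to bounds
`lo ≤ prior ≤ hi`, and an observation cost small enough for fact checking to beat lazy guessing. -/
structure Model.WarmStart (M : Model 𝒴 N) (c : ℝ) (lo hi : ℝ) : Prop where
  lo_pos : 0 < lo
  lo_le : ∀ y, lo ≤ M.prior y
  le_hi : ∀ y, M.prior y ≤ hi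
  dominant : ∀ i x y, y ≠ x → hi / lo * M.skill i y x ≤ M.skill i x x
  worth : ∀ i y, M.prior y + c ≤ ∑ x, M.prior x * M.skill i x x

end Algorithm

end DRAM

end

/-!
The proof separates a deterministic statement about mechanisms from a concentration bound.

*Mechanisms.* If `(μ', B')` estimates the law `(μ, B)` of a focal and a reference observation with
row-wise `ℓ¹` errors `2 s η`, then a mechanism with `|R| ≤ κ` that satisfies the constraints for
`(μ', B')` with margin `δ` satisfies them for `(μ, B)` with margin `0` as soon as `2 s η κ ≤ δ`.
The least possible `κ` is bounded by the explicit mechanism `R = r B'⁻ᵀ + b`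
(`exists_robustFeasible`), and the safety margin of the algorithm covers this bound even with
`s = 11 / 10` (`margin_slack`). The tie-breaking rule forces the interim payments to be exactly
`c + δ` (`IsRobustSolution.interim_payment`), whereas every mechanism that satisfies the original
constraints pays at least `c`; hence the regret of a round is at most `2 δ = O(η)`. All this is
collected in `robust_mechanism`.

*Concentration.* The number of observations on which an estimated conditional law is based is
random, and the number of epochs is of order `log₂ T`, not `log T`. At the nominal ambiguity level
a union bound would therefore just miss the tolerance `ε`. At `s = 11 / 10` times that level the
failure probabilities are of order `exp (-6 L / 5)`, which leaves enough room
(`IsSample.measureReal_condFreq_ge_le`, `IsSample.measureReal_not_forall_concentrated_le`).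

*Conclusion.* The event of concentration concerns the observations only. On it, honest reports in
the earlier rounds make the rules of a round truthful, so rational agents report honestly in all
rounds, by induction (`Input.Valid.reports_eq`). The ambiguity in round `t` is `O(√(L / (t + 1)))`,
and these bounds sum to `O(√(L T))` per agent.
-/

set_option linter.unusedSectionVars false

namespace DRAM

/-! ### Expectations in the labelling model -/

section Model

variable {𝒴 : Type*} [Fintype 𝒴] [DecidableEq 𝒴] {N : ℕ}

lemma Model.joint_nonneg (M : Model 𝒴 N) (y : 𝒴) (x : Fin N → 𝒴) : 0 ≤ M.joint y x :=
  mul_nonneg (M.prior_nonneg y) (Finset.prod_nonneg fun i _ => M.skill_nonneg i y (x i))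

lemma Model.expect_mono (M : Model 𝒴 N) {f g : 𝒴 → (Fin N → 𝒴) → ℝ} (h : ∀ y x, f y x ≤ g y x) :
    M.expect f ≤ M.expect g :=
  Finset.sum_le_sum fun y _ => Finset.sum_le_sum fun x _ =>
    mul_le_mul_of_nonneg_left (h y x) (M.joint_nonneg y x)

lemma Model.expect_nonneg (M : Model 𝒴 N) {f : 𝒴 → (Fin N → 𝒴) → ℝ} (h : ∀ y x, 0 ≤ f y x) :
    0 ≤ M.expect f :=
  Finset.sum_nonneg fun y _ => Finset.sum_nonneg fun x _ => mul_nonneg (M.joint_nonneg y x) (h y x)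

lemma Model.expect_sum (M : Model 𝒴 N) {ι : Type*} (s : Finset ι)
    (f : ι → 𝒴 → (Fin N → 𝒴) → ℝ) :
    M.expect (fun y x => ∑ a ∈ s, f a y x) = ∑ a ∈ s, M.expect (f a) := by
  simp only [Model.expect, Finset.mul_sum]
  calc _ = ∑ y, ∑ a ∈ s, ∑ x, M.joint y x * f a y x :=
        Finset.sum_congr rfl fun y _ => Finset.sum_comm
    _ = _ := Finset.sum_comm

lemma Model.expect_add (M : Model 𝒴 N) (f g : 𝒴 → (Fin N → 𝒴) → ℝ) :
    M.expect (fun y x => f y x + g y x) = M.expect f + M.expect g := by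
  simp only [Model.expect, mul_add, Finset.sum_add_distrib]

lemma Model.expect_mul_const (M : Model 𝒴 N) (f : 𝒴 → (Fin N → 𝒴) → ℝ) (a : ℝ) :
    M.expect (fun y x => f y x * a) = M.expect f * a := by
  simp only [Model.expect, Finset.sum_mul, mul_assoc]

lemma Model.sum_prod_skill (M : Model 𝒴 N) (y : 𝒴) (g : Fin N → 𝒴 → ℝ) :
    ∑ x : Fin N → 𝒴, (∏ i, M.skill i y (x i)) * ∏ i, g i (x i) =
      ∏ i, ∑ x, M.skill i y x * g i x := by
  rw [Finset.prod_univ_sum, Fintype.piFinset_univ]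
  simp only [Finset.prod_mul_distrib]

lemma Model.expect_one (M : Model 𝒴 N) : M.expect (fun _ _ => 1) = 1 := by
  simp only [Model.expect, Model.joint, mul_assoc, ← Finset.mul_sum]
  have h : ∀ y, ∑ x : Fin N → 𝒴, ∏ i, M.skill i y (x i) = 1 := by
    intro y
    simpa [M.skill_sum] using M.sum_prod_skill y fun _ _ => 1
  simp only [mul_one, h, M.prior_sum]

/-- Expectation of a function of the true label and of the observation of one agent. -/
lemma Model.expect_label_obs (M : Model 𝒴 N) (i : Fin N) (f : 𝒴 → 𝒴 → ℝ) :
    M.expect (fun y X => f y (X i)) = ∑ y, M.prior y * ∑ x, M.skill i y x * f y x := by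
  simp only [Model.expect, Model.joint, mul_assoc, ← Finset.mul_sum]
  refine Finset.sum_congr rfl fun y _ => ?_
  congr 1
  have h := M.sum_prod_skill y fun k x => if k = i then f y x else 1
  simp only [Finset.prod_ite_eq', Finset.mem_univ, if_true] at h
  rw [h, Finset.prod_eq_single i]
  · simp
  · intro k _ hk
    simp [hk, M.skill_sum]
  · simp

lemma Model.obsProb_nonneg (M : Model 𝒴 N) (i : Fin N) (x : 𝒴) : 0 ≤ M.obsProb i x :=
  M.expect_nonneg fun _ X => by split_ifs <;> norm_num

lemma Model.sum_obsProb (M : Model 𝒴 N) (i : Fin N) : ∑ x, M.obsProb i x = 1 := by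
  rw [← M.expect_one]
  simp only [Model.obsProb, ← M.expect_sum]
  congr 1
  funext y X
  simp

lemma Model.belief_nonneg (M : Model 𝒴 N) (i j : Fin N) (x x' : 𝒴) : 0 ≤ M.belief i j x x' :=
  div_nonneg (M.expect_nonneg fun _ X => by split_ifs <;> norm_num) (M.obsProb_nonneg i x)

lemma Model.obsProb_mul_belief (M : Model 𝒴 N) (i j : Fin N) {x : 𝒴} (hx : 0 < M.obsProb i x)
    (x' : 𝒴) : M.obsProb i x * M.belief i j x x' =
      M.expect fun _ X => if X i = x ∧ X j = x' then 1 else 0 := by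
  simp only [Model.belief, Matrix.of_apply]
  field_simp

lemma Model.belief_row_sum (M : Model 𝒴 N) (i j : Fin N) {x : 𝒴} (hx : 0 < M.obsProb i x) :
    ∑ x', M.belief i j x x' = 1 := by
  have h : M.obsProb i x * ∑ x', M.belief i j x x' = M.obsProb i x * 1 := by
    rw [Finset.mul_sum, mul_one]
    simp only [M.obsProb_mul_belief i j hx, ← M.expect_sum]
    unfold Model.obsProb
    congr 1
    funext y X
    by_cases h : X i = x <;> simp [h]
  exact mul_left_cancel₀ hx.ne' h

lemma Model.sum_obsProb_mul_belief (M : Model 𝒴 N) (i j : Fin N) (hμ : ∀ x, 0 < M.obsProb i x)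
    (x' : 𝒴) : ∑ x, M.obsProb i x * M.belief i j x x' = M.obsProb j x' := by
  simp only [M.obsProb_mul_belief i j (hμ _), ← M.expect_sum]
  unfold Model.obsProb
  congr 1
  funext y X
  by_cases h : X j = x' <;> simp [h]

/-- Expectation of a function of the observations of a focal and a reference agent. -/
lemma Model.expect_pair (M : Model 𝒴 N) (i j : Fin N) (hμ : ∀ x, 0 < M.obsProb i x)
    (f : 𝒴 → 𝒴 → ℝ) :
    M.expect (fun _ X => f (X i) (X j)) =
      ∑ x, M.obsProb i x * ∑ x', M.belief i j x x' * f x x' := by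
  have h : (fun (_ : 𝒴) (X : Fin N → 𝒴) => f (X i) (X j)) =
      fun _ X => ∑ x, ∑ x', (if X i = x ∧ X j = x' then 1 else 0) * f x x' := by
    funext _ X
    simp [ite_and]
  rw [h, M.expect_sum]
  refine Finset.sum_congr rfl fun x _ => ?_
  rw [M.expect_sum, Finset.mul_sum]
  refine Finset.sum_congr rfl fun x' _ => ?_
  rw [M.expect_mul_const _ (f x x'), ← mul_assoc, M.obsProb_mul_belief i j (hμ x)]

lemma Model.expect_obs (M : Model 𝒴 N) (j : Fin N) (f : 𝒴 → ℝ) :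
    M.expect (fun _ X => f (X j)) = ∑ x, M.obsProb j x * f x := by
  simp only [Model.obsProb, ← M.expect_mul_const, ← M.expect_sum]
  congr 1
  funext y X
  simp

/-! ### Truthfulness of the deployed rules -/

/-- A reward matrix that satisfies the constraints of the mechanism design problem under the true
law is a truthful rule. -/
lemma Model.truthful_of_marginFeasible (M : Model 𝒴 N) {c : ℝ} {i j : Fin N} (hij : j ≠ i)
    (hμ : ∀ x, 0 < M.obsProb i x) {R : Matrix 𝒴 𝒴 ℝ}
    (hR : MarginFeasible (M.obsProb i) (M.belief i j) c 0 R) :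
    M.Truthful c i (fun _ z => R (z i) (z j)) := by
  have hwork : ∀ s : 𝒴 → 𝒴, M.workUtility c i (fun _ z => R (z i) (z j)) s =
      (∑ x, M.obsProb i x * ∑ x', M.belief i j x x' * R (s x) x') - c := by
    intro s
    rw [← M.expect_pair i j hμ (fun x x' => R (s x) x')]
    simp [Model.workUtility, Function.update_of_ne hij]
  refine ⟨fun s => ?_, fun z => ?_⟩
  · rw [hwork, hwork]
    refine sub_le_sub_right (Finset.sum_le_sum fun x _ =>
      mul_le_mul_of_nonneg_left ?_ (hμ x).le) c
    by_cases h : s x = x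
    · simp [h]
    · exact (hR.no_lie x (s x) h).trans (by simpa using hR.rational x)
  · have hlazy : M.lazyUtility i (fun _ z => R (z i) (z j)) z ≤ 0 := by
      have h := hR.no_free_lunch z
      simp only [M.sum_obsProb_mul_belief i j hμ, neg_zero] at h
      rw [← M.expect_obs j] at h
      simpa [Model.lazyUtility, Function.update_of_ne hij] using h
    have hid : c ≤ ∑ x, M.obsProb i x * ∑ x', M.belief i j x x' * R (id x) x' := by
      calc c = ∑ x, M.obsProb i x * c := by rw [← Finset.sum_mul, M.sum_obsProb, one_mul]
        _ ≤ _ := by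
            gcongr with x _
            · exact (hμ x).le
            · simpa using hR.rational x
    rw [hwork]
    linarith

/-- Fact checking is truthful in the warm-start phase. -/
lemma Model.WarmStart.truthful {M : Model 𝒴 N} {c lo hi : ℝ} (h : M.WarmStart c lo hi)
    (i : Fin N) : M.Truthful c i (fun y z => if z i = y then 1 else 0) := by
  have hwork : ∀ s : 𝒴 → 𝒴, M.workUtility c i (fun y z => if z i = y then 1 else 0) s =
      (∑ x, M.prior (s x) * M.skill i (s x) x) - c := by
    intro s
    simp only [Model.workUtility, Function.update_self]
    rw [M.expect_label_obs i fun y x => if s x = y then 1 else 0]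
    simp only [Finset.mul_sum]
    rw [Finset.sum_comm]
    simp
  refine ⟨fun s => ?_, fun z => ?_⟩
  · rw [hwork, hwork]
    refine sub_le_sub_right (Finset.sum_le_sum fun x _ => ?_) c
    by_cases hs : s x = x
    · simp [hs]
    have hhi : 0 ≤ hi := (h.lo_pos.le.trans (h.lo_le x)).trans (h.le_hi x)
    calc M.prior (s x) * M.skill i (s x) x ≤ hi * M.skill i (s x) x :=
          mul_le_mul_of_nonneg_right (h.le_hi _) (M.skill_nonneg _ _ _)
      _ = lo * (hi / lo * M.skill i (s x) x) := by field_simp [h.lo_pos.ne']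
      _ ≤ lo * M.skill i x x :=
          mul_le_mul_of_nonneg_left (h.dominant i x (s x) hs) h.lo_pos.le
      _ ≤ M.prior x * M.skill i x x :=
          mul_le_mul_of_nonneg_right (h.lo_le x) (M.skill_nonneg _ _ _)
  · rw [hwork]
    have hz : M.lazyUtility i (fun y z => if z i = y then 1 else 0) z = M.prior z := by
      simp only [Model.lazyUtility, Function.update_self]
      rw [M.expect_label_obs i fun y _ => if z = y then 1 else 0]
      simp only [← Finset.sum_mul, M.skill_sum]
      simp
    have := h.worth i z
    simp only [id]
    linarith

lemma Model.expect_factCheck_le_one (M : Model 𝒴 N) (i : Fin N) :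
    M.expect (fun y z => if z i = y then 1 else 0) ≤ 1 := by
  refine le_of_le_of_eq (M.expect_mono fun y x => ?_) M.expect_one
  split_ifs <;> norm_num

end Model

/-! ### The spectral norm -/

section SpecNorm

variable {𝒴 : Type*} [Fintype 𝒴] [DecidableEq 𝒴]

lemma specNorm_nonneg (A : Matrix 𝒴 𝒴 ℝ) : 0 ≤ specNorm A := norm_nonneg _

lemma norm_mulVec_le_specNorm (A : Matrix 𝒴 𝒴 ℝ) (v : 𝒴 → ℝ) :
    ‖WithLp.toLp 2 (A.mulVec v)‖ ≤ specNorm A * ‖WithLp.toLp 2 v‖ :=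
  (Matrix.toEuclideanCLM (n := 𝒴) (𝕜 := ℝ) A).le_opNorm (WithLp.toLp 2 v)

lemma specNorm_mul_le (A B : Matrix 𝒴 𝒴 ℝ) : specNorm (A * B) ≤ specNorm A * specNorm B := by
  simp only [specNorm, map_mul]
  exact norm_mul_le _ _

lemma specNorm_add_le (A B : Matrix 𝒴 𝒴 ℝ) : specNorm (A + B) ≤ specNorm A + specNorm B := by
  simp only [specNorm, map_add]
  exact norm_add_le _ _

lemma specNorm_neg (A : Matrix 𝒴 𝒴 ℝ) : specNorm (-A) = specNorm A := by
  simp only [specNorm, map_neg, norm_neg]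

lemma abs_entry_le_specNorm (A : Matrix 𝒴 𝒴 ℝ) (x x' : 𝒴) : |A x x'| ≤ specNorm A := by
  have h1 := norm_mulVec_le_specNorm A (Pi.single x' 1)
  have h2 := PiLp.norm_apply_le (WithLp.toLp 2 (A.mulVec (Pi.single x' 1))) x
  have h3 : ‖WithLp.toLp 2 (Pi.single x' (1 : ℝ) : 𝒴 → ℝ)‖ = 1 := by
    simp
  rw [h3, mul_one] at h1
  simpa using h2.trans h1

/-- A matrix whose rows have `ℓ¹` norm at most `b` has spectral norm at most `√d * b`. -/
lemma specNorm_le_of_row_sum_le {A : Matrix 𝒴 𝒴 ℝ} {b : ℝ} (hb : 0 ≤ b)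
    (hA : ∀ x, ∑ x', |A x x'| ≤ b) : specNorm A ≤ Real.sqrt (Fintype.card 𝒴) * b := by
  refine ContinuousLinearMap.opNorm_le_bound _ (by positivity) fun v => ?_
  have hrow : ∀ x, |(A.mulVec v.ofLp) x| ≤ b * ‖v‖ := by
    intro x
    calc |(A.mulVec v.ofLp) x| ≤ ∑ x', |A x x' * v x'| := Finset.abs_sum_le_sum_abs _ _
      _ ≤ ∑ x', |A x x'| * ‖v‖ := by
          refine Finset.sum_le_sum fun x' _ => ?_
          rw [abs_mul]
          exact mul_le_mul_of_nonneg_left (PiLp.norm_apply_le v x') (abs_nonneg _)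
      _ ≤ b * ‖v‖ := by
          rw [← Finset.sum_mul]
          exact mul_le_mul_of_nonneg_right (hA x) (norm_nonneg _)
  rw [EuclideanSpace.norm_eq]
  refine Real.sqrt_le_iff.2 ⟨by positivity, ?_⟩
  calc ∑ x, ‖(Matrix.toEuclideanCLM (n := 𝒴) (𝕜 := ℝ) A v) x‖ ^ 2
      ≤ ∑ _x : 𝒴, (b * ‖v‖) ^ 2 := by
        refine Finset.sum_le_sum fun x _ => ?_
        exact pow_le_pow_left₀ (norm_nonneg _) (hrow x) 2
    _ = (Real.sqrt (Fintype.card 𝒴) * b * ‖v‖) ^ 2 := by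
        simp only [Finset.sum_const, Finset.card_univ, nsmul_eq_mul, mul_pow,
          Real.sq_sqrt (Nat.cast_nonneg (α := ℝ) (Fintype.card 𝒴))]
        ring

lemma mulVec_one_of_row_sum {B : Matrix 𝒴 𝒴 ℝ} (hrow : ∀ x, ∑ x', B x x' = 1) :
    B.mulVec (fun _ => 1) = fun _ => 1 := by
  funext x
  simp [Matrix.mulVec, dotProduct, hrow]

lemma one_le_specNorm_inv [Nonempty 𝒴] {B : Matrix 𝒴 𝒴 ℝ} (hB : IsUnit B.det)
    (hrow : ∀ x, ∑ x', B x x' = 1) : 1 ≤ specNorm B⁻¹ := by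
  have h1 : B⁻¹.mulVec (fun _ => (1 : ℝ)) = fun _ => 1 := by
    conv_lhs => rw [← mulVec_one_of_row_sum hrow, Matrix.mulVec_mulVec, Matrix.nonsing_inv_mul B hB,
      Matrix.one_mulVec]
  have h2 := norm_mulVec_le_specNorm B⁻¹ (fun _ => (1 : ℝ))
  rw [h1] at h2
  have h3 : 0 < ‖WithLp.toLp 2 (fun _ : 𝒴 => (1 : ℝ))‖ := by
    obtain ⟨x⟩ := ‹Nonempty 𝒴›
    refine lt_of_lt_of_le (by norm_num) (PiLp.norm_apply_le (WithLp.toLp 2 fun _ : 𝒴 => (1 : ℝ)) x)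
  exact le_of_mul_le_mul_right (by simpa using h2) h3

/-- Stability of the inverse under a perturbation of relative size `q < 1`. -/
lemma isUnit_det_of_specNorm_sub_le {B B' : Matrix 𝒴 𝒴 ℝ} {q : ℝ} (hB : IsUnit B.det)
    (hq : q < 1) (h : specNorm B⁻¹ * specNorm (B' - B) ≤ q) :
    IsUnit B'.det ∧ specNorm B'⁻¹ * (1 - q) ≤ specNorm B⁻¹ := by
  have hunit : IsUnit B'.det := by
    rw [isUnit_iff_ne_zero]
    intro h0
    obtain ⟨v, hv, hBv⟩ := Matrix.exists_mulVec_eq_zero_iff.2 h0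
    have h1 : v = (-(B⁻¹ * (B' - B))).mulVec v := by
      rw [mul_sub, Matrix.nonsing_inv_mul B hB, neg_sub, Matrix.sub_mulVec, Matrix.one_mulVec,
        ← Matrix.mulVec_mulVec, hBv, Matrix.mulVec_zero, sub_zero]
    have h2 := norm_mulVec_le_specNorm (-(B⁻¹ * (B' - B))) v
    rw [← h1, specNorm_neg] at h2
    have hpos : 0 < ‖WithLp.toLp 2 v‖ := by
      rw [norm_pos_iff]
      intro h0
      exact hv (by simpa using h0)
    have h3 := (specNorm_mul_le B⁻¹ (B' - B)).trans h
    nlinarith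
  refine ⟨hunit, ?_⟩
  have h1 : B'⁻¹ = B⁻¹ + -(B⁻¹ * (B' - B) * B'⁻¹) := by
    rw [mul_sub, Matrix.nonsing_inv_mul B hB, sub_mul, one_mul, mul_assoc,
      Matrix.mul_nonsing_inv B' hunit, mul_one]
    abel
  have h2 : specNorm B'⁻¹ ≤ specNorm B⁻¹ + q * specNorm B'⁻¹ := by
    conv_lhs => rw [h1]
    refine (specNorm_add_le _ _).trans ?_
    rw [specNorm_neg]
    gcongr
    refine (specNorm_mul_le _ _).trans ?_
    exact mul_le_mul_of_nonneg_right ((specNorm_mul_le _ _).trans h) (specNorm_nonneg _)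
  linarith

end SpecNorm

/-! ### Existence and structure of robust mechanisms -/

section Mechanism

variable {𝒴 : Type*} [Fintype 𝒴] [DecidableEq 𝒴]

lemma sum_marginal_mul (μ : 𝒴 → ℝ) (B : Matrix 𝒴 𝒴 ℝ) (f : 𝒴 → ℝ) :
    ∑ x', (∑ x, μ x * B x x') * f x' = ∑ x, μ x * ∑ x', B x x' * f x' := by
  simp only [Finset.sum_mul, Finset.mul_sum, mul_assoc]
  exact Finset.sum_comm

/-- The mechanism whose interim payments are `c + δ` for an honest report and a constant negative
amount for a lie, chosen so that no free lunch holds; it is read off from the inverse of the belief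
matrix. -/
lemma exists_robustFeasible {μ : 𝒴 → ℝ} {B : Matrix 𝒴 𝒴 ℝ} {c δ g : ℝ} (hB : IsUnit B.det)
    (hrow : ∀ x, ∑ x', B x x' = 1) (hsum : ∑ x, μ x = 1) (hg0 : 0 ≤ g)
    (hμg : ∀ x, μ x ≤ g) (hg : g < 1) (hc : 0 ≤ c) (hδ : 0 ≤ δ) :
    ∃ R, RobustFeasible μ B c δ
      ((specNorm B⁻¹ * (c + 2 * δ) + (g * (c + δ) + δ)) / (1 - g)) R := by
  have hg1 : 0 < 1 - g := by linarith
  set b : ℝ := -((g * (c + δ) + δ) / (1 - g)) with hb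
  set r : ℝ := (c + 2 * δ) / (1 - g) with hr
  have hab : r + b = c + δ := by
    rw [hb, hr]; field_simp; ring
  have hr0 : 0 ≤ r := by positivity
  have hbδ : b ≤ -δ := by
    rw [hb, neg_le_neg_iff, le_div_iff₀ hg1]
    nlinarith [mul_nonneg hg0 hc, mul_nonneg hg0 hδ]
  have hpay : ∀ x z, ∑ x', B x x' * (r * B⁻¹ x' z + b) = r * (if x = z then 1 else 0) + b := by
    intro x z
    have h : (B * B⁻¹) x z = if x = z then 1 else 0 := by
      rw [Matrix.mul_nonsing_inv B hB, Matrix.one_apply]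
    rw [← h, Matrix.mul_apply, Finset.mul_sum]
    calc _ = ∑ x', r * (B x x' * B⁻¹ x' z) + ∑ x', B x x' * b := by
          rw [← Finset.sum_add_distrib]
          exact Finset.sum_congr rfl fun _ _ => by ring
      _ = _ := by rw [← Finset.sum_mul, hrow, one_mul]
  refine ⟨fun z x' => r * B⁻¹ x' z + b, fun z x' => ?_, fun x => ?_, fun x z hz => ?_, fun z => ?_⟩
  · have h1 := abs_le.1 (abs_entry_le_specNorm B⁻¹ x' z)
    have h2 : (specNorm B⁻¹ * (c + 2 * δ) + (g * (c + δ) + δ)) / (1 - g) =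
        r * specNorm B⁻¹ - b := by
      rw [hb, hr]; ring
    rw [h2, abs_le]
    constructor <;> nlinarith
  · rw [hpay, if_pos rfl]
    linarith
  · rw [hpay, if_neg (Ne.symm hz)]
    linarith
  · rw [sum_marginal_mul]
    have h1 : ∑ x, μ x * ∑ x', B x x' * (r * B⁻¹ x' z + b) = μ z * r + b := by
      simp only [hpay]
      simp only [mul_add, Finset.sum_add_distrib]
      rw [← Finset.sum_mul, hsum, one_mul]
      simp
    have h2 : g * r + b = -δ := by
      rw [hb, hr]; field_simp; ring
    refine h1.trans_le ?_
    nlinarith [hμg z]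

/-- By compactness, a margin problem with a feasible point has a solution. -/
lemma RobustFeasible.exists_isRobustSolution [Nonempty 𝒴] {μ : 𝒴 → ℝ} {B : Matrix 𝒴 𝒴 ℝ}
    {c δ κ : ℝ} {R : Matrix 𝒴 𝒴 ℝ} (h : RobustFeasible μ B c δ κ R) :
    ∃ R', IsRobustSolution μ B c δ R' := by
  have hκ : ∀ {κ' : ℝ} {R' : Matrix 𝒴 𝒴 ℝ}, RobustFeasible μ B c δ κ' R' → 0 ≤ κ' := by
    intro κ' R' h'
    obtain ⟨x⟩ := ‹Nonempty 𝒴›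
    exact (abs_nonneg _).trans (h'.1 x x)
  let S : Set (ℝ × (𝒴 → 𝒴 → ℝ)) := {p | RobustFeasible μ B c δ p.1 p.2 ∧ p.1 ≤ κ}
  have hS : S = {p | (∀ z x', |p.2 z x'| ≤ p.1) ∧ (∀ x, c + δ ≤ ∑ x', B x x' * p.2 x x') ∧
      (∀ x z, z ≠ x → ∑ x', B x x' * p.2 z x' ≤ c - δ) ∧
      (∀ z, ∑ x', (∑ x, μ x * B x x') * p.2 z x' ≤ -δ) ∧ p.1 ≤ κ} := by
    ext p
    constructor
    · rintro ⟨⟨h1, h2, h3, h4⟩, h5⟩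
      exact ⟨h1, h2, h3, h4, h5⟩
    · rintro ⟨h1, h2, h3, h4, h5⟩
      exact ⟨⟨h1, h2, h3, h4⟩, h5⟩
  have hclosed : IsClosed S := by
    rw [hS]
    simp only [Set.ofPred_and, Set.ofPred_forall]
    refine IsClosed.inter ?_ (IsClosed.inter ?_ (IsClosed.inter ?_ (IsClosed.inter ?_ ?_)))
    · exact isClosed_iInter fun z => isClosed_iInter fun x' =>
        isClosed_le (by fun_prop) (by fun_prop)
    · exact isClosed_iInter fun x => isClosed_le (by fun_prop) (by fun_prop)
    · exact isClosed_iInter fun x => isClosed_iInter fun z => isClosed_iInter fun _ =>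
        isClosed_le (by fun_prop) (by fun_prop)
    · exact isClosed_iInter fun z => isClosed_le (by fun_prop) (by fun_prop)
    · exact isClosed_le (by fun_prop) (by fun_prop)
  have hcompact : IsCompact S := by
    refine (isCompact_Icc (a := ((0 : ℝ), fun (_ _ : 𝒴) => -κ))
      (b := (κ, fun (_ _ : 𝒴) => κ))).of_isClosed_subset hclosed ?_
    rintro p ⟨hp, hpκ⟩
    refine ⟨⟨hκ hp, fun z x' => ?_⟩, ⟨hpκ, fun z x' => ?_⟩⟩
    · exact (neg_le_neg hpκ).trans (abs_le.1 (hp.1 z x')).1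
    · exact (abs_le.1 (hp.1 z x')).2.trans hpκ
  obtain ⟨p, hp, hmin⟩ := hcompact.exists_isMinOn ⟨(κ, R), h, le_rfl⟩ continuous_fst.continuousOn
  have hκmin : ∀ κ' R', RobustFeasible μ B c δ κ' R' → p.1 ≤ κ' := by
    intro κ' R' h'
    by_cases hle : κ' ≤ κ
    · exact isMinOn_iff.1 hmin (κ', R') ⟨h', hle⟩
    · exact hp.2.trans (not_le.1 hle).le
  have hcompact' : IsCompact (S ∩ {q | q.1 = p.1}) :=
    hcompact.inter_right (isClosed_eq continuous_fst continuous_const)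
  obtain ⟨q, hq, hqmin⟩ := hcompact'.exists_isMinOn ⟨p, hp, rfl⟩
    (f := fun q => ∑ x, μ x * ∑ x', B x x' * q.2 x x') (by fun_prop)
  obtain ⟨⟨hq1, hq2⟩, hq3⟩ := hq
  refine ⟨q.2, p.1, ?_, hκmin, fun R' hR' => ?_⟩
  · have hq3' : q.1 = p.1 := hq3
    rwa [hq3'] at hq1
  · exact isMinOn_iff.1 hqmin (p.1, R') ⟨⟨hR', hp.2⟩, rfl⟩

/-- A solution of the margin problem pays an honest agent exactly `c + δ`, whatever her
observation: a row that pays more can be moved towards the constant `-κ`, which keeps it within the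
bounds and relaxes the upper constraints. -/
lemma IsRobustSolution.interim_payment {μ : 𝒴 → ℝ} {B : Matrix 𝒴 𝒴 ℝ} {c δ : ℝ}
    {R : Matrix 𝒴 𝒴 ℝ} (h : IsRobustSolution μ B c δ R) (hμ : ∀ x, 0 < μ x)
    (hBnn : ∀ x x', 0 ≤ B x x') (hrow : ∀ x, ∑ x', B x x' = 1) (hcδ : 0 ≤ c + δ) (x : 𝒴) :
    ∑ x', B x x' * R x x' = c + δ := by
  obtain ⟨κ, hR, -, hmin⟩ := h
  refine le_antisymm ?_ (hR.2.rational x)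
  by_contra! hlt
  have hκ : 0 ≤ κ := (abs_nonneg _).trans (hR.1 x x)
  set a : ℝ := ∑ x', B x x' * R x x' with ha
  have haκ : 0 < a + κ := by linarith
  set θ : ℝ := (a - (c + δ)) / (a + κ) with hθ
  have hθ0 : 0 < θ := div_pos (by linarith) haκ
  have hθ1 : θ ≤ 1 := (div_le_one haκ).2 (by linarith)
  let R' : Matrix 𝒴 𝒴 ℝ := fun z x' => if z = x then (1 - θ) * R z x' + θ * (-κ) else R z x'
  have hle : ∀ z x', R' z x' ≤ R z x' := by
    intro z x'
    have := (abs_le.1 (hR.1 z x')).1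
    simp only [R']
    split_ifs
    · nlinarith
    · exact le_rfl
  have hx : ∑ x', B x x' * R' x x' = c + δ := by
    have : ∑ x', B x x' * R' x x' = (1 - θ) * a + θ * (-κ) := by
      calc ∑ x', B x x' * R' x x'
          = ∑ x', ((1 - θ) * (B x x' * R x x') + B x x' * (θ * (-κ))) := by
            refine Finset.sum_congr rfl fun x' _ => ?_
            simp only [R', if_true]
            ring
        _ = _ := by
            rw [Finset.sum_add_distrib, ← Finset.mul_sum, ← Finset.sum_mul, hrow, one_mul]
    rw [this]
    have : θ * (a + κ) = a - (c + δ) := by rw [hθ]; field_simp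
    linarith
  have hfeas : RobustFeasible μ B c δ κ R' := by
    refine ⟨fun z x' => ?_, fun x₁ => ?_, fun x₁ z hz => ?_, fun z => ?_⟩
    · have h1 := abs_le.1 (hR.1 z x')
      refine abs_le.2 ⟨?_, (hle z x').trans h1.2⟩
      simp only [R']
      split_ifs
      · nlinarith
      · exact h1.1
    · by_cases h1 : x₁ = x
      · rw [h1, hx]
      · simpa [R', h1] using hR.2.rational x₁
    · exact (Finset.sum_le_sum fun x' _ => mul_le_mul_of_nonneg_left (hle z x')
        (hBnn x₁ x')).trans (hR.2.no_lie x₁ z hz)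
    · refine (Finset.sum_le_sum fun x' _ => mul_le_mul_of_nonneg_left (hle z x') ?_).trans
        (hR.2.no_free_lunch z)
      exact Finset.sum_nonneg fun x₁ _ => mul_nonneg (hμ x₁).le (hBnn x₁ x')
  refine absurd (hmin R' hfeas) (not_le.2 ?_)
  refine Finset.sum_lt_sum (fun x₁ _ => ?_) ⟨x, Finset.mem_univ x, ?_⟩
  · exact mul_le_mul_of_nonneg_left (Finset.sum_le_sum fun x' _ =>
      mul_le_mul_of_nonneg_left (hle x₁ x') (hBnn x₁ x')) (hμ x₁).le
  · rw [hx]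
    exact mul_lt_mul_of_pos_left hlt (hμ x)

/-- In the original problem the agent is paid at least her cost. -/
lemma le_optimalPayment {μ : 𝒴 → ℝ} {B : Matrix 𝒴 𝒴 ℝ} {c g : ℝ} (hB : IsUnit B.det)
    (hrow : ∀ x, ∑ x', B x x' = 1) (hμ : ∀ x, 0 ≤ μ x) (hsum : ∑ x, μ x = 1) (hg0 : 0 ≤ g)
    (hμg : ∀ x, μ x ≤ g) (hg : g < 1) (hc : 0 ≤ c) : c ≤ optimalPayment μ B c := by
  obtain ⟨R, -, hR⟩ := exists_robustFeasible hB hrow hsum hg0 hμg hg hc le_rfl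
  refine le_csInf ⟨_, R, hR, rfl⟩ ?_
  rintro _ ⟨R', hR', rfl⟩
  calc c = ∑ x, μ x * c := by rw [← Finset.sum_mul, hsum, one_mul]
    _ ≤ _ := Finset.sum_le_sum fun x _ =>
      mul_le_mul_of_nonneg_left (by simpa using hR'.rational x) (hμ x)

/-! ### Robustness to estimation errors -/

/-- The estimation error of an expected reward, in terms of the `ℓ¹` error of the law. -/
lemma abs_sum_mul_sub_le {p p' r : 𝒴 → ℝ} {κ b : ℝ} (hr : ∀ x, |r x| ≤ κ) (hκ : 0 ≤ κ)
    (h : ∑ x, |p' x - p x| ≤ b) : |∑ x, p' x * r x - ∑ x, p x * r x| ≤ b * κ := by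
  rw [← Finset.sum_sub_distrib]
  calc |∑ x, (p' x * r x - p x * r x)| ≤ ∑ x, |p' x * r x - p x * r x| :=
        Finset.abs_sum_le_sum_abs _ _
    _ ≤ ∑ x, |p' x - p x| * κ := by
        refine Finset.sum_le_sum fun x _ => ?_
        rw [← sub_mul, abs_mul]
        exact mul_le_mul_of_nonneg_left (hr x) (abs_nonneg _)
    _ ≤ b * κ := by
        rw [← Finset.sum_mul]
        exact mul_le_mul_of_nonneg_right h hκ

/-- The numerical slack of the safety margin. With `u = 2‖B⁻¹‖η` it says that the margin still
covers estimation errors that are a factor `11 / 10` larger than the nominal ambiguity, when the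
observation frequencies are only known to be at most `γ + 11 / 20 * u`. -/
lemma margin_slack {d γ u : ℝ} (hd : 2 ≤ d) (hγd : 1 ≤ γ * d) (hγ0 : 0 ≤ γ) (hγ1 : γ < 1)
    (hu : 0 ≤ u) (huG : u * ((1 + γ) * d + 2) ≤ 30 / 49 * (1 - γ)) :
    11 / 10 * u * (1 + (γ + 11 / 20 * u)) * ((1 - γ) - u * ((1 + γ) * d + 2)) ≤
      u * (γ * d + 1) * ((1 - (γ + 11 / 20 * u)) - 11 / 10 * u * (3 + (γ + 11 / 20 * u))) := by
  have hG : 4 + 2 * γ ≤ (1 + γ) * d + 2 := by nlinarith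
  have hG5 : 5 ≤ (1 + γ) * d + 2 := by nlinarith
  have hu5 : 5 * u ≤ 30 / 49 * (1 - γ) := by nlinarith
  have hd' : 4 / 3 * (1 + γ) ≤ γ * d + 1 := by nlinarith
  have hbr : 0 ≤ (1 - (γ + 11 / 20 * u)) - 11 / 10 * u * (3 + (γ + 11 / 20 * u)) := by
    nlinarith
  have h1 : 11 / 10 * (1 + (γ + 11 / 20 * u)) * ((1 - γ) - u * ((1 + γ) * d + 2)) ≤
      4 / 3 * (1 + γ) * ((1 - (γ + 11 / 20 * u)) - 11 / 10 * u * (3 + (γ + 11 / 20 * u))) := by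
    have hu2 : u * (803 / 600 * (1 - γ) + 121 / 150 * u) ≤ 7 / 30 * (1 - γ) := by
      have h3 : 803 / 600 * (1 - γ) + 121 / 150 * u ≤ 3 / 2 := by linarith
      nlinarith
    have h4 := mul_le_mul_of_nonneg_left hu2 (by linarith : 0 ≤ 1 + γ)
    have h5 : 0 ≤ 11 / 10 * (1 + γ) * u * ((1 + γ) * d + 2 - (4 + 2 * γ)) :=
      mul_nonneg (by positivity) (by linarith)
    have h6 : 0 ≤ 121 / 200 * u * (u * ((1 + γ) * d + 2)) := by positivity
    have h7 : 0 ≤ u * γ * (1 - γ) := mul_nonneg (mul_nonneg hu hγ0) (by linarith)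
    linarith
  have h2 := mul_le_mul_of_nonneg_right hd' hbr
  nlinarith [mul_le_mul_of_nonneg_left (h1.trans h2) hu]

set_option maxHeartbeats 400000 in
/-- **Robustness of the margin problem.** Suppose that `(μ', B')` estimates the true law `(μ, B)`
up to a factor `11 / 10` of the ambiguity `η`, which is at most half of the threshold. Then the
problem designed with `(μ', B')` has a solution, and each solution satisfies the constraints of the
original problem under the true law, with an expected payment that exceeds the cost by `O(η)`. -/
lemma robust_mechanism {μ μ' : 𝒴 → ℝ} {B B' : Matrix 𝒴 𝒴 ℝ} {γ η η₀ c : ℝ}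
    (hd : 2 ≤ Fintype.card 𝒴)
    (hμ : ∀ x, 0 < μ x) (hμsum : ∑ x, μ x = 1) (hμγ : ∀ x, μ x ≤ γ) (hγ : γ < 1)
    (hB : IsUnit B.det) (hrow : ∀ x, ∑ x', B x x' = 1)
    (hμ' : ∀ x, 0 < μ' x) (hμsum' : ∑ x, μ' x = 1)
    (hBnn' : ∀ x x', 0 ≤ B' x x') (hrow' : ∀ x, ∑ x', B' x x' = 1)
    (hdev : ∀ x, ∑ x', |B' x x' - B x x'| ≤ 11 / 5 * η)
    (hmarg : ∑ x', |(∑ x, μ' x * B' x x') - ∑ x, μ x * B x x'| ≤ 11 / 5 * η)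
    (hfreq : ∀ x, μ' x ≤ μ x + 11 / 10 * η)
    (hη : 0 < η) (hηη₀ : η ≤ η₀) (hη₀ : η₀ ≤ agentThreshold B γ / 2) (hc : 0 < c) :
    (∃ R, IsRobustSolution μ' B' c (safetyMargin B' γ η c) R) ∧
      ∀ R, IsRobustSolution μ' B' c (safetyMargin B' γ η c) R →
        MarginFeasible μ B c 0 R ∧ pairPayment μ B R ≤ c + 4 * c / η₀ * η := by
  have : Nonempty 𝒴 := Fintype.card_pos_iff.1 (by omega)
  have hd2 : (2 : ℝ) ≤ Fintype.card 𝒴 := by exact_mod_cast hd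
  set d : ℝ := (Fintype.card 𝒴 : ℝ) with hdd
  have hη₀pos : 0 < η₀ := hη.trans_le hηη₀
  have hγd : 1 ≤ γ * d := by
    calc (1 : ℝ) = ∑ x, μ x := hμsum.symm
      _ ≤ ∑ _x : 𝒴, γ := Finset.sum_le_sum fun x _ => hμγ x
      _ = γ * d := by simp [hdd, mul_comm]
  have hγ0 : 0 < γ := by
    by_contra! h
    nlinarith
  set β : ℝ := specNorm B⁻¹ with hβ
  set β' : ℝ := specNorm B'⁻¹ with hβ'
  have hβ1 : 1 ≤ β := one_le_specNorm_inv hB hrow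
  set G : ℝ := (1 + γ) * d + 2 with hG
  have hGd : d + 3 ≤ G := by rw [hG]; linarith
  have hGpos : 0 < G := by linarith
  -- the threshold in a form free of division
  have hthr : 4 * (β * η₀ * G) ≤ 1 - γ := by
    have h1 : η₀ ≤ (1 - γ) / (2 * β * G) / 2 := hη₀
    rw [div_div, le_div_iff₀ (by positivity)] at h1
    linarith
  have hthr' : 4 * (β * η * G) ≤ 1 - γ := by
    refine le_trans ?_ hthr
    gcongr
  -- the empirical belief matrix is invertible, and its inverse is hardly larger
  have hq : β * specNorm (B' - B) ≤ 11 / 60 * (1 - γ) := by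
    have h1 : specNorm (B' - B) ≤ Real.sqrt d * (11 / 5 * η) :=
      specNorm_le_of_row_sum_le (by positivity) hdev
    have h2 : Real.sqrt d ≤ G / 3 := by
      refine Real.sqrt_le_iff.2 ⟨by positivity, ?_⟩
      nlinarith [sq_nonneg (d - 3 / 2)]
    have h3 : specNorm (B' - B) ≤ G / 3 * (11 / 5 * η) :=
      h1.trans (mul_le_mul_of_nonneg_right h2 (by positivity))
    have h4 := mul_le_mul_of_nonneg_left h3 (by linarith : 0 ≤ β)
    linarith
  have hq' : 11 / 60 * (1 - γ) < 1 := by linarith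
  obtain ⟨hB', hββ'⟩ := isUnit_det_of_specNorm_sub_le hB hq' hq
  have hβ1' : 1 ≤ β' := one_le_specNorm_inv hB' hrow'
  have hββ : β' ≤ 60 / 49 * β := by
    rw [← hβ', ← hβ] at hββ'
    nlinarith
  set u : ℝ := 2 * β' * η with hu
  have hu0 : 0 < u := by positivity
  have hηu : 2 * η ≤ u := by rw [hu]; nlinarith
  have huG : u * G ≤ 30 / 49 * (1 - γ) := by
    have h1 : u * G ≤ 2 * (60 / 49 * β) * η * G := by
      rw [hu]
      gcongr
    linarith
  set D : ℝ := (1 - γ) - u * G with hD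
  have hDγ : 19 / 49 * (1 - γ) ≤ D := by rw [hD]; linarith
  have hDpos : 0 < D := by linarith
  set δ : ℝ := safetyMargin B' γ η c with hδ
  have hδeq : δ = u * (γ * d + 1) / D * c := by
    rw [hδ, hD, hu, hG]
    simp only [safetyMargin, ← hβ', ← hdd]
    congr 2
    · ring
    · ring
  have hδD : δ * D = u * (γ * d + 1) * c := by
    rw [hδeq]
    field_simp
  have hδpos : 0 < δ := by
    rw [hδeq]
    have : 0 < γ * d + 1 := by linarith
    positivity
  -- the explicit mechanism bounds the optimal `κ`
  set g : ℝ := γ + 11 / 20 * u with hg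
  have hg1 : g < 1 := by
    have h1 : u * 5 ≤ u * G := mul_le_mul_of_nonneg_left (by linarith) hu0.le
    rw [hg]
    linarith
  have hg0 : 0 < g := by positivity
  have hμg : ∀ x, μ' x ≤ g := fun x => by
    have h1 := hfreq x
    have h2 := hμγ x
    rw [hg]
    linarith
  obtain ⟨R₀, hR₀⟩ := exists_robustFeasible (c := c) (δ := δ) hB' hrow' hμsum'
    hg0.le hμg hg1 hc.le hδpos.le
  have hκ₀ : 11 / 5 * η * ((β' * (c + 2 * δ) + (g * (c + δ) + δ)) / (1 - g)) ≤ δ := by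
    have hg1' : 0 < 1 - g := by linarith
    rw [mul_div_assoc', div_le_iff₀ hg1']
    have h1 : β' * (c + 2 * δ) + (g * (c + δ) + δ) ≤ β' * ((1 + g) * c + (3 + g) * δ) := by
      have h2 : 0 ≤ g * (c + δ) + δ := by positivity
      linarith [mul_le_mul_of_nonneg_right hβ1' h2]
    have h2 : 11 / 5 * η * (β' * (c + 2 * δ) + (g * (c + δ) + δ)) ≤
        11 / 10 * u * ((1 + g) * c + (3 + g) * δ) := by
      have := mul_le_mul_of_nonneg_left h1 (by positivity : 0 ≤ 11 / 5 * η)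
      rw [hu]
      linarith
    have h3 := mul_le_mul_of_nonneg_right (margin_slack hd2 hγd hγ0.le hγ hu0.le huG) hc.le
    have h4 : 11 / 10 * u * (1 + g) * c * D ≤
        δ * ((1 - g) - 11 / 10 * u * (3 + g)) * D := by
      calc _ = 11 / 10 * u * (1 + g) * D * c := by ring
        _ ≤ u * (γ * d + 1) * ((1 - g) - 11 / 10 * u * (3 + g)) * c := h3
        _ = u * (γ * d + 1) * c * ((1 - g) - 11 / 10 * u * (3 + g)) := by ring
        _ = _ := by rw [← hδD]; ring
    have h5 := le_of_mul_le_mul_right h4 hDpos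
    linarith
  refine ⟨hR₀.exists_isRobustSolution, fun R hR => ?_⟩
  have hpay := hR.interim_payment hμ' hBnn' hrow' (by positivity)
  obtain ⟨κ, hRf, hκmin, -⟩ := hR
  have hκ0 : 0 ≤ κ := by
    obtain ⟨x⟩ := ‹Nonempty 𝒴›
    exact (abs_nonneg _).trans (hRf.1 x x)
  have hκδ : 11 / 5 * η * κ ≤ δ :=
    (mul_le_mul_of_nonneg_left (hκmin _ _ hR₀) (by positivity)).trans hκ₀
  have herr : ∀ x z, |∑ x', B' x x' * R z x' - ∑ x', B x x' * R z x'| ≤ δ := fun x z =>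
    (abs_sum_mul_sub_le (hRf.1 z) hκ0 (hdev x)).trans hκδ
  have hδη : 2 * δ ≤ 4 * c / η₀ * η := by
    have h1 : u * η₀ * (γ * d + 1) ≤ 30 / 49 * (1 - γ) * η := by
      have h2 : γ * d + 1 ≤ G := by rw [hG]; linarith
      calc u * η₀ * (γ * d + 1) ≤ (2 * (60 / 49 * β) * η) * η₀ * G := by
            rw [hu]
            gcongr
        _ ≤ 30 / 49 * (1 - γ) * η := by linarith [mul_le_mul_of_nonneg_right hthr hη.le]
    have h3 : u * η₀ * (γ * d + 1) ≤ 2 * D * η := by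
      have h4 : 0 ≤ (1 - γ) * η := mul_nonneg (by linarith) hη.le
      linarith [mul_le_mul_of_nonneg_right hDγ hη.le]
    rw [div_mul_eq_mul_div, le_div_iff₀ hη₀pos]
    refine le_of_mul_le_mul_right ?_ hDpos
    calc 2 * δ * η₀ * D = 2 * η₀ * (δ * D) := by ring
      _ = 2 * (u * η₀ * (γ * d + 1)) * c := by rw [hδD]; ring
      _ ≤ 2 * (2 * D * η) * c := by gcongr
      _ = 4 * c * η * D := by ring
  refine ⟨⟨fun x => ?_, fun x z hz => ?_, fun z => ?_⟩, ?_⟩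
  · have h1 := (abs_le.1 (herr x x)).2
    rw [hpay x] at h1
    linarith
  · have h1 := (abs_le.1 (herr x z)).1
    have h2 := hRf.2.no_lie x z hz
    linarith
  · have h1 := (abs_le.1 ((abs_sum_mul_sub_le (hRf.1 z) hκ0 hmarg).trans hκδ)).1
    have h2 := hRf.2.no_free_lunch z
    linarith
  · calc pairPayment μ B R ≤ ∑ x, μ x * (c + 2 * δ) := by
          refine Finset.sum_le_sum fun x _ => mul_le_mul_of_nonneg_left ?_ (hμ x).le
          have h1 := (abs_le.1 (herr x x)).1
          rw [hpay x] at h1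
          linarith
      _ = c + 2 * δ := by rw [← Finset.sum_mul, hμsum, one_mul]
      _ ≤ _ := by linarith

end Mechanism

/-! ### Concentration of empirical frequencies -/

section Concentration

variable {𝒴 : Type*} [Fintype 𝒴] [DecidableEq 𝒴] {N : ℕ}

/-- Hoeffding's lemma for a centred Bernoulli variable of mean `q`. -/
lemma bernoulli_mgf_le {q : ℝ} (h0 : 0 ≤ q) (h1 : q ≤ 1) (r : ℝ) :
    q * Real.exp (r * (1 - q)) + (1 - q) * Real.exp (r * (0 - q)) ≤ Real.exp (r ^ 2 / 8) := by
  let ν : Measure ℝ := ENNReal.ofReal q • Measure.dirac 1 + ENNReal.ofReal (1 - q) • Measure.dirac 0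
  have hν : IsProbabilityMeasure ν := ⟨by
    simp only [ν, Measure.add_apply, Measure.smul_apply, measure_univ, smul_eq_mul, mul_one]
    rw [← ENNReal.ofReal_add h0 (by linarith)]
    simp⟩
  have hint : ∀ f : ℝ → ℝ, ∫ x, f x ∂ν = q * f 1 + (1 - q) * f 0 := by
    intro f
    have hd : ∀ a : ℝ, Integrable f (Measure.dirac a) := fun a =>
      (integrable_dirac (by simp))
    simp only [ν]
    rw [integral_add_measure ((hd 1).smul_measure (by simp)) ((hd 0).smul_measure (by simp)),
      integral_smul_measure, integral_smul_measure, integral_dirac, integral_dirac,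
      ENNReal.toReal_ofReal h0, ENNReal.toReal_ofReal (by linarith)]
    simp
  have hsub := hasSubgaussianMGF_of_mem_Icc (μ := ν) (X := id) (a := 0) (b := 1)
    aemeasurable_id (by
      have hd : ∀ a ∈ Set.Icc (0 : ℝ) 1, ∀ᵐ ω ∂(Measure.dirac a), id ω ∈ Set.Icc (0 : ℝ) 1 :=
        fun a ha => (ae_dirac_iff (measurableSet_Icc)).2 ha
      simp only [ν]
      rw [ae_add_measure_iff]
      exact ⟨Measure.ae_smul_measure (hd 1 (by simp)) _, Measure.ae_smul_measure (hd 0 (by simp)) _⟩)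
  have h := hsub.mgf_le r
  have hm : ∫ x, id x ∂ν = q := by rw [hint]; simp
  rw [mgf, hint, hm] at h
  refine h.trans (le_of_eq ?_)
  congr 1
  norm_num
  ring

variable [MeasurableSpace 𝒴] [MeasurableSingletonClass 𝒴] {Ω : Type*} [MeasurableSpace Ω]

lemma IsSample.integral_eq {M : Model 𝒴 N} {P : Measure Ω} [IsProbabilityMeasure P]
    {Y : ℕ → Ω → 𝒴} {X : ℕ → Ω → Fin N → 𝒴} (h : IsSample M P Y X) (t : ℕ)
    (f : 𝒴 → (Fin N → 𝒴) → ℝ) : ∫ ω, f (Y t ω) (X t ω) ∂P = M.expect f := by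
  have hm : Measurable fun ω => (Y t ω, X t ω) :=
    (h.measurable_label t).prodMk (h.measurable_obs t)
  have h1 : ∫ ω, f (Y t ω) (X t ω) ∂P =
      ∫ z, f z.1 z.2 ∂(P.map fun ω => (Y t ω, X t ω)) := by
    rw [integral_map hm.aemeasurable (Measurable.of_discrete).aestronglyMeasurable]
  have : IsProbabilityMeasure (P.map fun ω => (Y t ω, X t ω)) :=
    Measure.isProbabilityMeasure_map hm.aemeasurable
  rw [h1, integral_fintype (Integrable.of_finite), Fintype.sum_prod_type]
  refine Finset.sum_congr rfl fun y _ => Finset.sum_congr rfl fun x _ => ?_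
  rw [measureReal_def, Measure.map_apply hm (measurableSet_singleton _)]
  have h2 : (fun ω => (Y t ω, X t ω)) ⁻¹' {(y, x)} = {ω | Y t ω = y ∧ X t ω = x} := by
    ext ω; simp
  rw [h2, h.law, ENNReal.toReal_ofReal (M.joint_nonneg y x), smul_eq_mul]

/-- **Chernoff bound for conditional frequencies.** If `S` has probability `p` and `F` has
conditional probability `q` given `S`, the frequency of `F` among the rounds in which `S` occurs is
unlikely to reach `q + b`. The bound accounts for the random number of these rounds: it is the
`n`-th power of the moment generating function of `1_S (1_F - q - b)` at `4 b`. -/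
lemma IsSample.measureReal_condFreq_ge_le {M : Model 𝒴 N} {P : Measure Ω} [IsProbabilityMeasure P]
    {Y : ℕ → Ω → 𝒴} {X : ℕ → Ω → Fin N → 𝒴} (h : IsSample M P Y X)
    (S F : (Fin N → 𝒴) → Prop) [DecidablePred S] [DecidablePred F] {p q b : ℝ} (hp0 : 0 ≤ p)
    (hp : M.expect (fun _ x => if S x then 1 else 0) = p)
    (hpq : M.expect (fun _ x => if S x ∧ F x then 1 else 0) = q * p)
    (hq0 : 0 ≤ q) (hq1 : q ≤ 1) (hb : 0 ≤ b) (n : ℕ) :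
    P.real {ω | (q + b) * ((Finset.range n).filter fun t => S (X t ω)).card ≤
        ((Finset.range n).filter fun t => S (X t ω) ∧ F (X t ω)).card} ≤
      Real.exp (-(n * (p * (1 - Real.exp (-(2 * b ^ 2)))))) := by
  let W : (Fin N → 𝒴) → ℝ := fun x =>
    (if S x ∧ F x then 1 else 0) - (q + b) * (if S x then 1 else 0)
  let e₁ : ℝ := Real.exp (4 * b * (1 - (q + b)))
  let e₀ : ℝ := Real.exp (4 * b * (0 - (q + b)))
  have hexp : ∀ x, Real.exp (4 * b * W x) =
      1 + (if S x ∧ F x then 1 else 0) * (e₁ - e₀) + (if S x then 1 else 0) * (e₀ - 1) := by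
    intro x
    by_cases hS : S x <;> by_cases hF : F x <;> simp only [W, hS, hF, e₁, e₀] <;> simp
    ring
  have hmgf : ∀ t, mgf (fun ω => W (X t ω)) P (4 * b) ≤
      Real.exp (-(p * (1 - Real.exp (-(2 * b ^ 2))))) := by
    intro t
    have h1 : mgf (fun ω => W (X t ω)) P (4 * b) = 1 + q * p * (e₁ - e₀) + p * (e₀ - 1) := by
      rw [mgf, h.integral_eq t fun _ x => Real.exp (4 * b * W x)]
      simp only [hexp]
      rw [M.expect_add (fun _ x => 1 + (if S x ∧ F x then 1 else 0) * (e₁ - e₀)),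
        M.expect_add (fun _ _ => 1), M.expect_mul_const (fun _ x => if S x ∧ F x then 1 else 0),
        M.expect_mul_const (fun _ x => if S x then 1 else 0), M.expect_one, hpq, hp]
    have h2 : q * e₁ + (1 - q) * e₀ ≤ Real.exp (-(2 * b ^ 2)) := by
      have h3 := bernoulli_mgf_le hq0 hq1 (4 * b)
      have h4 : ∀ v : ℝ, Real.exp (4 * b * (v - (q + b))) =
          Real.exp (-(4 * b ^ 2)) * Real.exp (4 * b * (v - q)) := by
        intro v
        rw [← Real.exp_add]
        ring_nf
      calc q * e₁ + (1 - q) * e₀ = Real.exp (-(4 * b ^ 2)) *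
            (q * Real.exp (4 * b * (1 - q)) + (1 - q) * Real.exp (4 * b * (0 - q))) := by
            simp only [e₁, e₀, h4]
            ring
        _ ≤ Real.exp (-(4 * b ^ 2)) * Real.exp ((4 * b) ^ 2 / 8) := by gcongr
        _ = _ := by
            rw [← Real.exp_add]
            ring_nf
    rw [h1]
    have h5 := Real.add_one_le_exp (-(p * (1 - Real.exp (-(2 * b ^ 2)))))
    have h6 := mul_le_mul_of_nonneg_left h2 hp0
    linarith
  have hmeas : ∀ t, Measurable fun ω => W (X t ω) := fun t =>
    (Measurable.of_discrete (f := W)).comp (h.measurable_obs t)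
  have hindep : iIndepFun (fun t ω => W (X t ω)) P :=
    h.indep.comp (fun _ z => W z.2) fun _ => Measurable.of_discrete
  have hint : ∀ t, Integrable (fun ω => Real.exp (4 * b * W (X t ω))) P := by
    intro t
    have : IsProbabilityMeasure (P.map (X t)) :=
      Measure.isProbabilityMeasure_map (h.measurable_obs t).aemeasurable
    exact (Integrable.of_finite (μ := P.map (X t))
      (f := fun x => Real.exp (4 * b * W x))).comp_measurable (h.measurable_obs t)
  have hset : {ω | (q + b) * ((Finset.range n).filter fun t => S (X t ω)).card ≤
        (((Finset.range n).filter fun t => S (X t ω) ∧ F (X t ω)).card : ℝ)} =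
      {ω | 0 ≤ (∑ t ∈ Finset.range n, fun ω => W (X t ω)) ω} := by
    ext ω
    simp only [Set.mem_ofPred_eq, Finset.sum_apply, W, Finset.sum_sub_distrib, ← Finset.mul_sum,
      Finset.sum_boole, sub_nonneg]
  rw [hset]
  refine (measure_ge_le_exp_mul_mgf 0 (by positivity : 0 ≤ 4 * b)
    (hindep.integrable_exp_mul_sum hmeas fun t _ => hint t)).trans ?_
  rw [hindep.mgf_sum hmeas, mul_zero, Real.exp_zero, one_mul]
  refine (Finset.prod_le_prod (fun t _ => mgf_nonneg) fun t _ => hmgf t).trans (le_of_eq ?_)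
  rw [Finset.prod_const, Finset.card_range, ← Real.exp_nat_mul]
  ring_nf

/-- The first `n` report profiles of `h` estimate, with one-sided errors below `b` for all sets of
labels, the belief matrix of agent `i` with reference `j` and the marginal law of agent `i`. -/
def Model.Concentrated (M : Model 𝒴 N) (h : ℕ → Fin N → 𝒴) (n : ℕ) (b : ℝ) (i j : Fin N) : Prop :=
  (∀ (x : 𝒴) (A : Finset 𝒴),
    (((Finset.range n).filter fun t => h t i = x ∧ h t j ∈ A).card : ℝ) <
      (∑ x' ∈ A, M.belief i j x x' + b) * ((Finset.range n).filter fun t => h t i = x).card) ∧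
  ∀ A : Finset 𝒴, (((Finset.range n).filter fun t => h t i ∈ A).card : ℝ) <
    (∑ x ∈ A, M.obsProb i x + b) * n

/-- Union bound over the conditioning label (or its absence) and the set of labels. -/
lemma IsSample.measureReal_not_concentrated_le {M : Model 𝒴 N} {P : Measure Ω}
    [IsProbabilityMeasure P] {Y : ℕ → Ω → 𝒴} {X : ℕ → Ω → Fin N → 𝒴} (h : IsSample M P Y X)
    {i : Fin N} {ρ b : ℝ} (hρ : 0 < ρ) (hρ1 : ρ ≤ 1) (hρi : ∀ x, ρ ≤ M.obsProb i x) (hb : 0 ≤ b)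
    (n : ℕ) (j : Fin N) :
    P.real {ω | ¬ M.Concentrated (fun t => X t ω) n b i j} ≤
      ((Fintype.card 𝒴 : ℝ) + 1) * 2 ^ Fintype.card 𝒴 *
        Real.exp (-(n * (ρ * (1 - Real.exp (-(2 * b ^ 2)))))) := by
  have hpos : ∀ x, 0 < M.obsProb i x := fun x => hρ.trans_le (hρi x)
  set e : ℝ := Real.exp (-(n * (ρ * (1 - Real.exp (-(2 * b ^ 2)))))) with he
  have hmono : ∀ p, ρ ≤ p → Real.exp (-(n * (p * (1 - Real.exp (-(2 * b ^ 2)))))) ≤ e := by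
    intro p hp
    have h1 : 0 ≤ 1 - Real.exp (-(2 * b ^ 2)) := by
      have : Real.exp (-(2 * b ^ 2)) ≤ 1 := Real.exp_le_one_iff.2 (by nlinarith [sq_nonneg b])
      linarith
    rw [he]
    gcongr
  let E : Option 𝒴 × Finset 𝒴 → Set Ω := fun oA => match oA with
    | (some x, A) => {ω | (∑ x' ∈ A, M.belief i j x x' + b) *
        ((Finset.range n).filter fun t => X t ω i = x).card ≤
        (((Finset.range n).filter fun t => X t ω i = x ∧ X t ω j ∈ A).card : ℝ)}
    | (none, A) => {ω | (∑ x ∈ A, M.obsProb i x + b) *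
        ((Finset.range n).filter fun _ => True).card ≤
        (((Finset.range n).filter fun t => True ∧ X t ω i ∈ A).card : ℝ)}
  have hsub : {ω | ¬ M.Concentrated (fun t => X t ω) n b i j} ⊆ ⋃ oA, E oA := by
    intro ω hω
    simp only [Set.mem_ofPred_eq, Model.Concentrated, not_and_or, not_forall, not_lt] at hω
    rcases hω with ⟨x, A, hxA⟩ | ⟨A, hA⟩
    · exact Set.mem_iUnion.2 ⟨(some x, A), hxA⟩
    · refine Set.mem_iUnion.2 ⟨(none, A), ?_⟩
      simpa [E] using hA
  have hE : ∀ oA, P.real (E oA) ≤ e := by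
    rintro ⟨_ | x, A⟩
    · refine (h.measureReal_condFreq_ge_le (fun _ => True) (fun x => x i ∈ A) zero_le_one ?_ ?_ ?_ ?_
        hb n).trans (hmono 1 hρ1)
      · simpa using M.expect_one
      · simp only [true_and, mul_one, Model.obsProb, ← M.expect_sum]
        congr 1
        funext _ x
        simp
      · exact Finset.sum_nonneg fun x _ => M.obsProb_nonneg i x
      · rw [← M.sum_obsProb i]
        exact Finset.sum_le_sum_of_subset_of_nonneg (Finset.subset_univ A)
          fun x _ _ => M.obsProb_nonneg i x
    · refine (h.measureReal_condFreq_ge_le (fun z => z i = x) (fun z => z j ∈ A) (hpos x).le rfl ?_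
        ?_ ?_ hb n).trans (hmono _ (hρi x))
      · rw [mul_comm, Finset.mul_sum]
        simp only [M.obsProb_mul_belief i j (hpos x), ← M.expect_sum]
        congr 1
        funext _ z
        by_cases hz : z i = x <;> simp [hz]
      · exact Finset.sum_nonneg fun x' _ => M.belief_nonneg i j x x'
      · rw [← M.belief_row_sum i j (hpos x)]
        exact Finset.sum_le_sum_of_subset_of_nonneg (Finset.subset_univ A)
          fun x' _ _ => M.belief_nonneg i j x x'
  calc P.real {ω | ¬ M.Concentrated (fun t => X t ω) n b i j} ≤ P.real (⋃ oA, E oA) :=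
        measureReal_mono hsub
    _ ≤ ∑ oA, P.real (E oA) := measureReal_iUnion_fintype_le E
    _ ≤ ∑ _oA : Option 𝒴 × Finset 𝒴, e := Finset.sum_le_sum fun oA _ => hE oA
    _ = _ := by simp

end Concentration

/-! ### Empirical laws on the event of concentration -/

section Empirical

variable {𝒴 : Type*} [Fintype 𝒴] [DecidableEq 𝒴] {N : ℕ}

/-- One-sided errors on all sets control the `ℓ¹` distance of two laws. -/
lemma sum_abs_sub_le_of_forall_finset {p p' : 𝒴 → ℝ} {b : ℝ} (h1 : ∑ x, p x = 1)
    (h1' : ∑ x, p' x = 1) (h : ∀ A : Finset 𝒴, ∑ x ∈ A, p' x ≤ ∑ x ∈ A, p x + b) :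
    ∑ x, |p' x - p x| ≤ 2 * b := by
  have h2 : ∑ x, |p' x - p x| =
      ∑ x, (2 * (if p x ≤ p' x then p' x - p x else 0) - (p' x - p x)) := by
    refine Finset.sum_congr rfl fun x _ => ?_
    split_ifs with hx
    · rw [abs_of_nonneg (by linarith)]; ring
    · rw [abs_of_nonpos (by linarith)]; ring
  have h3 := h (Finset.univ.filter fun x => p x ≤ p' x)
  rw [h2, Finset.sum_sub_distrib, Finset.sum_sub_distrib, h1, h1', ← Finset.mul_sum,
    ← Finset.sum_filter, Finset.sum_sub_distrib]
  linarith

lemma sum_card_filter_and_eq (h : ℕ → Fin N → 𝒴) (n : ℕ) (j : Fin N) (Q : ℕ → Prop)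
    [DecidablePred Q] (A : Finset 𝒴) :
    ∑ x ∈ A, (((Finset.range n).filter fun t => Q t ∧ h t j = x).card : ℝ) =
      ((Finset.range n).filter fun t => Q t ∧ h t j ∈ A).card := by
  simp only [← Finset.sum_boole]
  rw [Finset.sum_comm]
  refine Finset.sum_congr rfl fun t _ => ?_
  by_cases hQ : Q t <;> simp [hQ]

lemma sum_card_filter_eq (h : ℕ → Fin N → 𝒴) (n : ℕ) (j : Fin N) (A : Finset 𝒴) :
    ∑ x ∈ A, (((Finset.range n).filter fun t => h t j = x).card : ℝ) =
      ((Finset.range n).filter fun t => h t j ∈ A).card := by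
  simpa using sum_card_filter_and_eq h n j (fun _ => True) A

lemma empiricalLaw_sum (h : ℕ → Fin N → 𝒴) {n : ℕ} (hn : 0 < n) (i : Fin N) :
    ∑ x, empiricalLaw h n i x = 1 := by
  have hn' : (n : ℝ) ≠ 0 := by positivity
  simp only [empiricalLaw]
  rw [← Finset.sum_div, sum_card_filter_eq]
  simp [hn']

lemma empiricalLaw_mul_empiricalBelief (h : ℕ → Fin N → 𝒴) (n : ℕ) (i j : Fin N) (x x' : 𝒴) :
    empiricalLaw h n i x * empiricalBelief h n i j x x' =
      (((Finset.range n).filter fun t => h t i = x ∧ h t j = x').card : ℝ) / n := by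
  simp only [empiricalLaw, empiricalBelief, Matrix.of_apply]
  by_cases h0 : ((Finset.range n).filter fun t => h t i = x).card = 0
  · have h1 : ((Finset.range n).filter fun t => h t i = x ∧ h t j = x').card = 0 := by
      refine Nat.le_zero.1 (h0 ▸ Finset.card_le_card fun t ht => ?_)
      simp only [Finset.mem_filter] at ht ⊢
      exact ⟨ht.1, ht.2.1⟩
    simp [h0, h1]
  · have : (((Finset.range n).filter fun t => h t i = x).card : ℝ) ≠ 0 := by exact_mod_cast h0
    field_simp

lemma sum_empiricalLaw_mul_empiricalBelief (h : ℕ → Fin N → 𝒴) (n : ℕ) (i j : Fin N) (x' : 𝒴) :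
    ∑ x, empiricalLaw h n i x * empiricalBelief h n i j x x' = empiricalLaw h n j x' := by
  simp only [empiricalLaw_mul_empiricalBelief]
  rw [← Finset.sum_div, empiricalLaw]
  congr 1
  have := sum_card_filter_and_eq h n i (fun t => h t j = x') Finset.univ
  simpa [and_comm] using this

namespace Model.Concentrated

variable {M : Model 𝒴 N} {h : ℕ → Fin N → 𝒴} {n : ℕ} {b : ℝ} {i j : Fin N}

lemma card_pos (H : M.Concentrated h n b i j) (x : 𝒴) :
    0 < (((Finset.range n).filter fun t => h t i = x).card : ℝ) := by
  refine lt_of_le_of_ne (Nat.cast_nonneg _) fun h0 => ?_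
  have := H.1 x ∅
  rw [← h0] at this
  simp at this

lemma length_pos (H : M.Concentrated h n b i j) : 0 < n := by
  refine Nat.pos_of_ne_zero fun h0 => ?_
  have := H.2 ∅
  simp [h0] at this

lemma empiricalLaw_pos (H : M.Concentrated h n b i j) (x : 𝒴) : 0 < empiricalLaw h n i x :=
  div_pos (H.card_pos x) (by exact_mod_cast H.length_pos)

lemma sum_empiricalLaw_le (H : M.Concentrated h n b i j) (A : Finset 𝒴) :
    ∑ x ∈ A, empiricalLaw h n i x ≤ ∑ x ∈ A, M.obsProb i x + b := by
  have hn : (0 : ℝ) < n := by exact_mod_cast H.length_pos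
  simp only [empiricalLaw]
  rw [← Finset.sum_div, sum_card_filter_eq, div_le_iff₀ hn]
  exact (H.2 A).le

lemma empiricalBelief_row_sum (H : M.Concentrated h n b i j) (x : 𝒴) :
    ∑ x', empiricalBelief h n i j x x' = 1 := by
  simp only [empiricalBelief, Matrix.of_apply]
  rw [← Finset.sum_div, sum_card_filter_and_eq h n j (fun t => h t i = x)]
  simp only [Finset.mem_univ, and_true]
  exact div_self (H.card_pos x).ne'

lemma sum_empiricalBelief_le (H : M.Concentrated h n b i j) (x : 𝒴) (A : Finset 𝒴) :
    ∑ x' ∈ A, empiricalBelief h n i j x x' ≤ ∑ x' ∈ A, M.belief i j x x' + b := by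
  simp only [empiricalBelief, Matrix.of_apply]
  rw [← Finset.sum_div, sum_card_filter_and_eq h n j (fun t => h t i = x),
    div_le_iff₀ (H.card_pos x)]
  exact (H.1 x A).le

end Model.Concentrated

lemma empiricalBelief_nonneg (h : ℕ → Fin N → 𝒴) (n : ℕ) (i j : Fin N) (x x' : 𝒴) :
    0 ≤ empiricalBelief h n i j x x' := by
  simp only [empiricalBelief, Matrix.of_apply]
  positivity

/-- On the event of concentration the mechanism of an epoch is truthful under the true law, and its
expected payment exceeds the cost by `O(η)`. -/
lemma Model.Concentrated.mechanism {A : Input 𝒴 N} {M : Model 𝒴 N} (hA : A.Valid M)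
    (hρ : 0 < A.freq) (hc : 0 < A.cost) (hd : 2 ≤ Fintype.card 𝒴) {h : ℕ → Fin N → 𝒴} {k : ℕ}
    (hη : 0 < A.ambiguity k) (hηη₀ : A.ambiguity k ≤ A.threshold)
    (H : ∀ i, M.Concentrated h (A.epochEnd k) (11 / 10 * A.ambiguity k) i (A.ref i)) (i : Fin N) :
    MarginFeasible (M.obsProb i) (M.belief i (A.ref i)) A.cost 0 (A.mechanism h k i) ∧
      pairPayment (M.obsProb i) (M.belief i (A.ref i)) (A.mechanism h k i) ≤
        A.cost + 4 * A.cost / A.threshold * A.ambiguity k := by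
  have hpos : ∀ i x, 0 < M.obsProb i x := fun i x => hρ.trans_le (hA.freq_le i x)
  have hrow := fun x => M.belief_row_sum i (A.ref i) (hpos i x)
  have hn := (H i).length_pos
  obtain ⟨h1, h2⟩ := robust_mechanism hd (hpos i) (M.sum_obsProb i) (hA.le_maxFreq i)
    (hA.maxFreq_lt i) (hA.belief_invertible i) hrow (H i).empiricalLaw_pos
    (empiricalLaw_sum h hn i) (empiricalBelief_nonneg h (A.epochEnd k) i (A.ref i))
    (H i).empiricalBelief_row_sum
    (fun x => (sum_abs_sub_le_of_forall_finset (hrow x) ((H i).empiricalBelief_row_sum x)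
      ((H i).sum_empiricalBelief_le x)).trans (le_of_eq (by ring)))
    (by
      simp only [sum_empiricalLaw_mul_empiricalBelief, M.sum_obsProb_mul_belief i _ (hpos i)]
      exact (sum_abs_sub_le_of_forall_finset (M.sum_obsProb _) (empiricalLaw_sum h hn _)
        (H (A.ref i)).sum_empiricalLaw_le).trans (le_of_eq (by ring)))
    (fun x => by simpa using (H i).sum_empiricalLaw_le {x})
    hη hηη₀ (hA.threshold_le i) hc
  exact h2 _ (hA.oracle _ _ _ h1)

end Empirical

/-! ### The epoch schedule -/

section Schedule

variable {𝒴 : Type*} [Fintype 𝒴] [DecidableEq 𝒴] {N : ℕ}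

lemma Input.epochEnd_eq (A : Input 𝒴 N) (k : ℕ) : A.epochEnd k = 2 ^ k * A.warmLength := by
  induction k with
  | zero => simp [Input.epochEnd]
  | succ k ih => rw [Input.epochEnd, ih, pow_succ]; ring

lemma Input.epochEnd_epochIndex_le (A : Input 𝒴 N) {t : ℕ} (ht : A.warmLength ≤ t) :
    A.epochEnd (A.epochIndex t) ≤ t :=
  Nat.findGreatest_spec (P := fun k => A.epochEnd k ≤ t) (Nat.zero_le t) ht

lemma Input.lt_two_mul_epochEnd_epochIndex (A : Input 𝒴 N) {t : ℕ} (h0 : 0 < A.warmLength) :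
    t < 2 * A.epochEnd (A.epochIndex t) := by
  have hsucc : A.epochEnd (A.epochIndex t + 1) = 2 * A.epochEnd (A.epochIndex t) := by
    rw [A.epochEnd_eq, A.epochEnd_eq, pow_succ]; ring
  rw [← hsucc]
  by_contra! hle
  have h1 : A.epochIndex t + 1 ≤ t := by
    have h2 : A.epochIndex t + 1 < 2 ^ (A.epochIndex t + 1) := Nat.lt_two_pow_self
    have h3 : 2 ^ (A.epochIndex t + 1) ≤ A.epochEnd (A.epochIndex t + 1) := by
      rw [A.epochEnd_eq]
      exact Nat.le_mul_of_pos_right _ h0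
    omega
  have h2 := Nat.le_findGreatest (P := fun k => A.epochEnd k ≤ t) h1 hle
  have h3 : A.epochIndex t = Nat.findGreatest (fun k => A.epochEnd k ≤ t) t := rfl
  omega

lemma Input.Valid.two_le_card {A : Input 𝒴 N} {M : Model 𝒴 N} (hA : A.Valid M) (hN : 2 ≤ N) :
    2 ≤ Fintype.card 𝒴 := by
  by_contra! h
  let i : Fin N := ⟨0, by omega⟩
  have hsum := M.sum_obsProb i
  have hsub : Subsingleton 𝒴 := Fintype.card_le_one_iff_subsingleton.1 (by omega)
  rcases isEmpty_or_nonempty 𝒴 with he | ⟨⟨x⟩⟩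
  · simp at hsum
  · rw [Fintype.sum_subsingleton _ x] at hsum
    linarith [hA.le_maxFreq i x, hA.maxFreq_lt i]

lemma Input.Valid.freq_le_one {A : Input 𝒴 N} {M : Model 𝒴 N} (hA : A.Valid M) (hN : 2 ≤ N) :
    A.freq ≤ 1 := by
  have : Nonempty 𝒴 := Fintype.card_pos_iff.1 (by have := hA.two_le_card hN; omega)
  obtain ⟨x⟩ := this
  have i : Fin N := ⟨0, by omega⟩
  linarith [hA.freq_le i x, hA.le_maxFreq i x, hA.maxFreq_lt i]

/-- The ambiguity threshold is small, because the inverse of a stochastic matrix has norm at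
least `1`. -/
lemma Input.Valid.threshold_le_inv_twenty {A : Input 𝒴 N} {M : Model 𝒴 N} (hA : A.Valid M)
    (hρ : 0 < A.freq) (hN : 2 ≤ N) : A.threshold ≤ 1 / 20 := by
  have hd := hA.two_le_card hN
  have : Nonempty 𝒴 := Fintype.card_pos_iff.1 (by omega)
  let i : Fin N := ⟨0, by omega⟩
  have hpos : ∀ x, 0 < M.obsProb i x := fun x => hρ.trans_le (hA.freq_le i x)
  have hβ := one_le_specNorm_inv (hA.belief_invertible i) fun x =>
    M.belief_row_sum i (A.ref i) (hpos x)
  have hγd : 1 ≤ A.maxFreq i * Fintype.card 𝒴 := by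
    calc (1 : ℝ) = ∑ x, M.obsProb i x := (M.sum_obsProb i).symm
      _ ≤ ∑ _x : 𝒴, A.maxFreq i := Finset.sum_le_sum fun x _ => hA.le_maxFreq i x
      _ = A.maxFreq i * Fintype.card 𝒴 := by simp [mul_comm]
  have hd' : (2 : ℝ) ≤ Fintype.card 𝒴 := by exact_mod_cast hd
  have hG : 5 ≤ (1 + A.maxFreq i) * Fintype.card 𝒴 + 2 := by linarith
  have hγ0 : 0 ≤ A.maxFreq i := by
    obtain ⟨x⟩ := ‹Nonempty 𝒴›
    exact (hpos x).le.trans (hA.le_maxFreq i x)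
  refine (hA.threshold_le i).trans ?_
  have h1 : agentThreshold (M.belief i (A.ref i)) (A.maxFreq i) ≤ 1 / 10 := by
    unfold agentThreshold
    rw [div_le_div_iff₀ (by positivity) (by norm_num)]
    nlinarith [mul_le_mul hβ hG (by norm_num) (by linarith)]
  linarith

lemma Input.Valid.exp_logFactor {A : Input 𝒴 N} {M : Model 𝒴 N} (hA : A.Valid M) (hN : 2 ≤ N)
    (hT : 2 ≤ A.horizon) : Real.exp A.logFactor =
      ((Fintype.card 𝒴 : ℝ) + 1) * 2 ^ Fintype.card 𝒴 * N * Real.log A.horizon / A.tol := by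
  have hT' : (1 : ℝ) < A.horizon := by exact_mod_cast hT
  have hlog := Real.log_pos hT'
  have hN' : (0 : ℝ) < N := by exact_mod_cast (by omega : 0 < N)
  have := hA.tol_pos
  exact Real.exp_log (by positivity)

lemma log_horizon_gt {T : ℕ} (hT : 2 ≤ T) : 0.6931 < Real.log T := by
  have h1 : (2 : ℝ) ≤ T := by exact_mod_cast hT
  have h2 := Real.log_le_log (by norm_num) h1
  linarith [Real.log_two_gt_d9]

lemma Input.Valid.le_logFactor {A : Input 𝒴 N} {M : Model 𝒴 N} (hA : A.Valid M) (hN : 2 ≤ N)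
    (hT : 2 ≤ A.horizon) : 277 / 100 ≤ A.logFactor := by
  have hd : (2 : ℝ) ≤ Fintype.card 𝒴 := by exact_mod_cast hA.two_le_card hN
  have hpow : (4 : ℝ) ≤ 2 ^ Fintype.card 𝒴 := by
    calc (4 : ℝ) = 2 ^ 2 := by norm_num
      _ ≤ _ := pow_le_pow_right₀ (by norm_num) (hA.two_le_card hN)
  have hN' : (2 : ℝ) ≤ N := by exact_mod_cast hN
  have hlog := log_horizon_gt hT
  have h16 : (16 : ℝ) ≤ Real.exp A.logFactor := by
    rw [hA.exp_logFactor hN hT, le_div_iff₀ hA.tol_pos]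
    calc 16 * A.tol ≤ (2 + 1) * 4 * 2 * 0.6931 := by linarith [hA.tol_lt]
      _ ≤ _ := by gcongr
  have h1 : Real.log 16 ≤ A.logFactor := (Real.log_le_iff_le_exp (by norm_num)).2 h16
  have h2 : Real.log 16 = 4 * Real.log 2 := by
    rw [show (16 : ℝ) = 2 ^ 4 by norm_num, Real.log_pow]
    norm_num
  linarith [Real.log_two_gt_d9]

lemma Input.le_warmLength (A : Input 𝒴 N) (hρ : 0 < A.freq) (hη : 0 < A.threshold) :
    A.logFactor ≤ 2 * A.freq * (min A.threshold (1 / Real.sqrt 2)) ^ 2 * A.warmLength := by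
  have hm : 0 < min A.threshold (1 / Real.sqrt 2) := lt_min hη (by positivity)
  have := Nat.le_ceil (A.logFactor / (2 * A.freq * (min A.threshold (1 / Real.sqrt 2)) ^ 2))
  rw [div_le_iff₀ (by positivity)] at this
  rw [Input.warmLength]
  linarith

lemma Input.Valid.two_le_warmLength {A : Input 𝒴 N} {M : Model 𝒴 N} (hA : A.Valid M)
    (hρ : 0 < A.freq) (hη : 0 < A.threshold) (hN : 2 ≤ N) (hT : 2 ≤ A.horizon) :
    2 ≤ A.warmLength := by
  have h1 := A.le_warmLength hρ hη
  have h2 := hA.le_logFactor hN hT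
  have hm : 0 < min A.threshold (1 / Real.sqrt 2) := lt_min hη (by positivity)
  have hm' : (min A.threshold (1 / Real.sqrt 2)) ^ 2 ≤ 1 / 2 := by
    calc (min A.threshold (1 / Real.sqrt 2)) ^ 2 ≤ (1 / Real.sqrt 2) ^ 2 := by
          gcongr
          exact min_le_right _ _
      _ = 1 / 2 := by rw [div_pow, Real.sq_sqrt (by norm_num)]; norm_num
  have h3 : 2 * A.freq * (min A.threshold (1 / Real.sqrt 2)) ^ 2 ≤ 1 := by
    have := hA.freq_le_one hN
    nlinarith [sq_nonneg (min A.threshold (1 / Real.sqrt 2))]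
  have h4 : (277 / 100 : ℝ) ≤ A.warmLength := by
    have h5 := mul_le_mul_of_nonneg_right h3 (Nat.cast_nonneg (α := ℝ) A.warmLength)
    linarith
  by_contra! h
  have h6 : (A.warmLength : ℝ) ≤ 1 := by exact_mod_cast (by omega : A.warmLength ≤ 1)
  linarith

lemma Input.ambiguity_sq (A : Input 𝒴 N) (hρ : 0 < A.freq) (hL : 0 ≤ A.logFactor) (k : ℕ) :
    A.ambiguity k ^ 2 = A.logFactor / (2 * A.freq * A.epochEnd k) :=
  Real.sq_sqrt (by positivity)

lemma Input.Valid.epochEnd_pos {A : Input 𝒴 N} {M : Model 𝒴 N} (hA : A.Valid M)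
    (hρ : 0 < A.freq) (hη : 0 < A.threshold) (hN : 2 ≤ N) (hT : 2 ≤ A.horizon) (k : ℕ) :
    0 < A.epochEnd k := by
  have := hA.two_le_warmLength hρ hη hN hT
  rw [A.epochEnd_eq]
  positivity

lemma Input.Valid.ambiguity_pos {A : Input 𝒴 N} {M : Model 𝒴 N} (hA : A.Valid M)
    (hρ : 0 < A.freq) (hη : 0 < A.threshold) (hN : 2 ≤ N) (hT : 2 ≤ A.horizon) (k : ℕ) :
    0 < A.ambiguity k := by
  have h1 := hA.epochEnd_pos hρ hη hN hT k
  have h2 : 0 < A.logFactor := by linarith [hA.le_logFactor hN hT]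
  exact Real.sqrt_pos.2 (by positivity)

lemma Input.Valid.ambiguity_le_threshold {A : Input 𝒴 N} {M : Model 𝒴 N} (hA : A.Valid M)
    (hρ : 0 < A.freq) (hη : 0 < A.threshold) (hN : 2 ≤ N) (hT : 2 ≤ A.horizon) (k : ℕ) :
    A.ambiguity k ≤ A.threshold := by
  have h1 := hA.epochEnd_pos hρ hη hN hT k
  have hm : 0 < min A.threshold (1 / Real.sqrt 2) := lt_min hη (by positivity)
  refine Real.sqrt_le_iff.2 ⟨hη.le, ?_⟩
  rw [div_le_iff₀ (by positivity)]
  have h2 : (A.warmLength : ℝ) ≤ A.epochEnd k := by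
    rw [A.epochEnd_eq]
    exact_mod_cast Nat.le_mul_of_pos_left _ (by positivity)
  calc A.logFactor ≤ 2 * A.freq * (min A.threshold (1 / Real.sqrt 2)) ^ 2 * A.warmLength :=
        A.le_warmLength hρ hη
    _ ≤ 2 * A.freq * A.threshold ^ 2 * A.epochEnd k := by
        gcongr
        exact min_le_left _ _
    _ = _ := by ring

/-! ### Probability of concentration in all epochs -/

/-- At a level that exceeds the nominal ambiguity by a tenth, the exponent of the Chernoff bound
exceeds `L` by a fifth, in spite of the random number of observations. -/
lemma Input.Valid.exponent_ge {A : Input 𝒴 N} {M : Model 𝒴 N} (hA : A.Valid M)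
    (hρ : 0 < A.freq) (hη : 0 < A.threshold) (hN : 2 ≤ N) (hT : 2 ≤ A.horizon) (k : ℕ) :
    6 / 5 * A.logFactor ≤ A.epochEnd k *
      (A.freq * (1 - Real.exp (-(2 * (11 / 10 * A.ambiguity k) ^ 2)))) := by
  have hL : 0 < A.logFactor := by linarith [hA.le_logFactor hN hT]
  have hn : (0 : ℝ) < A.epochEnd k := by exact_mod_cast hA.epochEnd_pos hρ hη hN hT k
  have hsq : 2 * A.freq * A.epochEnd k * A.ambiguity k ^ 2 = A.logFactor := by
    rw [A.ambiguity_sq hρ hL.le k]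
    field_simp
  have hle : A.ambiguity k ≤ 1 / 20 :=
    (hA.ambiguity_le_threshold hρ hη hN hT k).trans (hA.threshold_le_inv_twenty hρ hN)
  have hpos := hA.ambiguity_pos hρ hη hN hT k
  have hle2 : A.ambiguity k ^ 2 ≤ 1 / 400 := by nlinarith
  set v : ℝ := A.ambiguity k ^ 2 with hv
  have hv0 : 0 ≤ v := sq_nonneg _
  have hx : 2 * (11 / 10 * A.ambiguity k) ^ 2 = 121 / 50 * v := by rw [hv]; ring
  have h1 : 12 / 5 * v ≤ 1 - Real.exp (-(121 / 50 * v)) := by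
    have h2 := Real.add_one_le_exp (121 / 50 * v)
    have h3 : Real.exp (-(121 / 50 * v)) ≤ 1 / (1 + 121 / 50 * v) := by
      rw [Real.exp_neg, ← one_div]
      exact one_div_le_one_div_of_le (by positivity) (by linarith)
    have h4 : 1 / (1 + 121 / 50 * v) ≤ 1 - 12 / 5 * v := by
      rw [div_le_iff₀ (by positivity)]
      nlinarith
    linarith
  rw [hx]
  calc 6 / 5 * A.logFactor = A.epochEnd k * (A.freq * (12 / 5 * v)) := by rw [← hsq]; ring
    _ ≤ _ := by gcongr

/-- The event of concentration, for the epochs that begin before round `T`, has probability at least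
`1 - ε`. There are at most `log₂ T` such epochs, and `1 / log 2` is absorbed by the excess of the
exponents over `L`. -/
lemma IsSample.measureReal_not_forall_concentrated_le [MeasurableSpace 𝒴]
    [MeasurableSingletonClass 𝒴] {Ω : Type*} [MeasurableSpace Ω] {A : Input 𝒴 N} {M : Model 𝒴 N}
    {P : Measure Ω} [IsProbabilityMeasure P] {Y : ℕ → Ω → 𝒴} {X : ℕ → Ω → Fin N → 𝒴}
    (h : IsSample M P Y X) (hA : A.Valid M) (hρ : 0 < A.freq) (hη : 0 < A.threshold) (hN : 2 ≤ N)
    (hT : 2 ≤ A.horizon) :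
    P.real {ω | ¬ ∀ k, A.epochEnd k < A.horizon → ∀ i,
      M.Concentrated (fun t => X t ω) (A.epochEnd k) (11 / 10 * A.ambiguity k) i (A.ref i)} ≤
      A.tol := by
  set E : ℕ → Fin N → Set Ω := fun k i => {ω | ¬ M.Concentrated (fun t => X t ω) (A.epochEnd k)
    (11 / 10 * A.ambiguity k) i (A.ref i)} with hE
  set D : ℝ := ((Fintype.card 𝒴 : ℝ) + 1) * 2 ^ Fintype.card 𝒴 with hD
  have hD0 : 0 < D := by positivity
  have hEle : ∀ k i, P.real (E k i) ≤ D * Real.exp (-(6 / 5 * A.logFactor)) := by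
    intro k i
    refine (h.measureReal_not_concentrated_le hρ (hA.freq_le_one hN) (hA.freq_le i)
      (by have := hA.ambiguity_pos hρ hη hN hT k; positivity) (A.epochEnd k) (A.ref i)).trans ?_
    have := hA.exponent_ge hρ hη hN hT k
    gcongr
  have hsub : {ω | ¬ ∀ k, A.epochEnd k < A.horizon → ∀ i, M.Concentrated (fun t => X t ω)
      (A.epochEnd k) (11 / 10 * A.ambiguity k) i (A.ref i)} ⊆
      ⋃ k ∈ Finset.range (Nat.log 2 A.horizon), ⋃ i ∈ Finset.univ, E k i := by
    intro ω hω
    simp only [Set.mem_ofPred_eq, not_forall] at hω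
    obtain ⟨k, hk, i, hi⟩ := hω
    simp only [Set.mem_iUnion, Finset.mem_range, Finset.mem_univ]
    refine ⟨k, ?_, i, trivial, hi⟩
    refine Nat.lt_of_succ_le (Nat.le_log_of_pow_le (by norm_num) ?_)
    have h2 := hA.two_le_warmLength hρ hη hN hT
    rw [A.epochEnd_eq] at hk
    calc 2 ^ (k + 1) = 2 ^ k * 2 := pow_succ 2 k
      _ ≤ 2 ^ k * A.warmLength := Nat.mul_le_mul_left _ h2
      _ ≤ A.horizon := hk.le
  have hlog2 : (Nat.log 2 A.horizon : ℝ) ≤ Real.log A.horizon / Real.log 2 := by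
    have := Real.natLog_le_logb A.horizon 2
    simpa [Real.logb] using this
  have hexp : Real.exp (-(1 / 5 * A.logFactor)) ≤ Real.log 2 := by
    have h1 := hA.le_logFactor hN hT
    have h2 := Real.add_one_le_exp (1 / 5 * A.logFactor)
    rw [Real.exp_neg]
    refine inv_le_of_inv_le₀ (by positivity) ?_
    have h3 : (Real.log 2)⁻¹ ≤ 1.45 := by
      refine inv_le_of_inv_le₀ (by norm_num) ?_
      have := Real.log_two_gt_d9
      norm_num at this ⊢
      linarith
    linarith
  have hl2 : 0 < Real.log 2 := Real.log_pos (by norm_num)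
  have hlogT : 0 < Real.log A.horizon := by linarith [log_horizon_gt hT]
  have hN' : (0 : ℝ) < N := by exact_mod_cast (by omega : 0 < N)
  calc _ ≤ P.real (⋃ k ∈ Finset.range (Nat.log 2 A.horizon), ⋃ i ∈ Finset.univ, E k i) :=
        measureReal_mono hsub (measure_ne_top _ _)
    _ ≤ ∑ k ∈ Finset.range (Nat.log 2 A.horizon), ∑ i : Fin N, P.real (E k i) :=
        (measureReal_biUnion_finset_le _ _).trans
          (Finset.sum_le_sum fun k _ => measureReal_biUnion_finset_le _ _)
    _ ≤ ∑ _k ∈ Finset.range (Nat.log 2 A.horizon), ∑ _i : Fin N,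
          D * Real.exp (-(6 / 5 * A.logFactor)) :=
        Finset.sum_le_sum fun k _ => Finset.sum_le_sum fun i _ => hEle k i
    _ = Nat.log 2 A.horizon * (N * (D * Real.exp (-(6 / 5 * A.logFactor)))) := by simp
    _ ≤ Real.log A.horizon / Real.log 2 * (N * (D * Real.exp (-(6 / 5 * A.logFactor)))) := by
        gcongr
    _ = Real.log A.horizon / Real.log 2 *
          (N * (D * ((Real.exp A.logFactor)⁻¹ * Real.exp (-(1 / 5 * A.logFactor))))) := by
        rw [← Real.exp_neg, ← Real.exp_add]
        ring_nf
    _ = A.tol * (Real.exp (-(1 / 5 * A.logFactor)) / Real.log 2) := by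
        have := hA.tol_pos
        rw [hA.exp_logFactor hN hT, ← hD]
        field_simp
    _ ≤ A.tol * 1 := by
        have := hA.tol_pos
        gcongr
        exact (div_le_one hl2).2 hexp
    _ = A.tol := mul_one _

/-! ### Truthfulness and regret on the event of concentration -/

lemma Model.Concentrated.congr {M : Model 𝒴 N} {h h' : ℕ → Fin N → 𝒴} {n : ℕ} {b : ℝ} {i j : Fin N}
    (hh : ∀ s < n, h s = h' s) (H : M.Concentrated h n b i j) : M.Concentrated h' n b i j := by
  have hf : ∀ (Q : (Fin N → 𝒴) → Prop) [DecidablePred Q],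
      ((Finset.range n).filter fun t => Q (h' t)) = (Finset.range n).filter fun t => Q (h t) :=
    fun Q _ => Finset.filter_congr fun t ht => by rw [hh t (Finset.mem_range.1 ht)]
  refine ⟨fun x A => ?_, fun A => ?_⟩
  · rw [hf fun z => z i = x ∧ z j ∈ A, hf fun z => z i = x]
    exact H.1 x A
  · rw [hf fun z => z i ∈ A]
    exact H.2 A

/-- If the reports before round `t` are honest, then on the event of concentration the rules of
round `t` are truthful. -/
lemma Input.Valid.truthful_rule {A : Input 𝒴 N} {M : Model 𝒴 N} (hA : A.Valid M)
    (hρ : 0 < A.freq) (hη : 0 < A.threshold) (hc : 0 < A.cost) (hN : 2 ≤ N) (hT : 2 ≤ A.horizon)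
    {lo hi : ℝ} (hW : M.WarmStart A.cost lo hi) {h : ℕ → Fin N → 𝒴} {t : ℕ}
    (H : ∀ k, A.epochEnd k ≤ t → ∀ i,
      M.Concentrated h (A.epochEnd k) (11 / 10 * A.ambiguity k) i (A.ref i)) (i : Fin N) :
    M.Truthful A.cost i (A.rule h t i) := by
  unfold Input.rule
  split_ifs with ht
  · exact hW.truthful i
  · have hk := A.epochEnd_epochIndex_le (not_lt.1 ht)
    exact M.truthful_of_marginFeasible (hA.ref_ne i) (fun x => hρ.trans_le (hA.freq_le i x))
      (Model.Concentrated.mechanism hA hρ hc (hA.two_le_card hN)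
        (hA.ambiguity_pos hρ hη hN hT _) (hA.ambiguity_le_threshold hρ hη hN hT _) (H _ hk) i).1

/-- Regret of one rule: at most `1` in the warm-start phase and `O(1 / √(t + 1))` afterwards. -/
lemma Input.Valid.regret_rule_le {A : Input 𝒴 N} {M : Model 𝒴 N} (hA : A.Valid M)
    (hρ : 0 < A.freq) (hη : 0 < A.threshold) (hc : 0 < A.cost) (hN : 2 ≤ N) (hT : 2 ≤ A.horizon)
    {h : ℕ → Fin N → 𝒴} {t : ℕ}
    (H : ∀ k, A.epochEnd k ≤ t → ∀ i,
      M.Concentrated h (A.epochEnd k) (11 / 10 * A.ambiguity k) i (A.ref i)) (i : Fin N) :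
    M.expect (A.rule h t i) - optimalPayment (M.obsProb i) (M.belief i (A.ref i)) A.cost ≤
      (if t < A.warmLength then 1 else 0) +
        4 * A.cost / A.threshold * Real.sqrt (A.logFactor / A.freq) * (1 / Real.sqrt (t + 1)) := by
  have hpos : ∀ x, 0 < M.obsProb i x := fun x => hρ.trans_le (hA.freq_le i x)
  have hcard := hA.two_le_card hN
  have hγ0 : 0 ≤ A.maxFreq i := by
    obtain ⟨x⟩ : Nonempty 𝒴 := Fintype.card_pos_iff.1 (by omega)
    exact (hpos x).le.trans (hA.le_maxFreq i x)
  have hopt := le_optimalPayment (hA.belief_invertible i)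
    (fun x => M.belief_row_sum i (A.ref i) (hpos x)) (fun x => (hpos x).le) (M.sum_obsProb i) hγ0
    (hA.le_maxFreq i) (hA.maxFreq_lt i) hc.le
  have hL : 0 < A.logFactor := by linarith [hA.le_logFactor hN hT]
  unfold Input.rule
  split_ifs with ht
  · have h1 := M.expect_factCheck_le_one i
    have h2 : 0 ≤ 4 * A.cost / A.threshold * Real.sqrt (A.logFactor / A.freq) *
        (1 / Real.sqrt (t + 1)) := by positivity
    linarith
  · have hk := A.epochEnd_epochIndex_le (not_lt.1 ht)
    have h1 := (Model.Concentrated.mechanism hA hρ hc hcard (hA.ambiguity_pos hρ hη hN hT _)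
      (hA.ambiguity_le_threshold hρ hη hN hT _) (H _ hk) i).2
    have h2 := M.expect_pair i (A.ref i) hpos (A.mechanism h (A.epochIndex t) i)
    have hn : (0 : ℝ) < A.epochEnd (A.epochIndex t) := by
      exact_mod_cast hA.epochEnd_pos hρ hη hN hT _
    have hlt : (t : ℝ) + 1 ≤ 2 * A.epochEnd (A.epochIndex t) := by
      exact_mod_cast A.lt_two_mul_epochEnd_epochIndex
        (by have := hA.two_le_warmLength hρ hη hN hT; omega)
    have h3 : A.ambiguity (A.epochIndex t) ≤
        Real.sqrt (A.logFactor / A.freq) * (1 / Real.sqrt (t + 1)) := by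
      rw [mul_one_div, ← Real.sqrt_div (by positivity), div_div]
      refine Real.sqrt_le_sqrt ?_
      refine div_le_div_of_nonneg_left hL.le (by positivity) ?_
      nlinarith
    have h4 := mul_le_mul_of_nonneg_left h3
      (by positivity : 0 ≤ 4 * A.cost / A.threshold)
    rw [h2]
    unfold pairPayment at h1
    linarith

lemma sum_one_div_sqrt_le (T : ℕ) :
    ∑ t ∈ Finset.range T, 1 / Real.sqrt ((t : ℝ) + 1) ≤ 2 * Real.sqrt T := by
  induction T with
  | zero => simp
  | succ T ih =>
    rw [Finset.sum_range_succ]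
    push_cast
    have h0 : 0 < Real.sqrt ((T : ℝ) + 1) := by positivity
    have h1 : Real.sqrt ((T : ℝ) + 1) ^ 2 = T + 1 := Real.sq_sqrt (by positivity)
    have h2 : Real.sqrt (T : ℝ) ^ 2 = T := Real.sq_sqrt (by positivity)
    have h3 : 1 / Real.sqrt ((T : ℝ) + 1) ≤
        2 * Real.sqrt ((T : ℝ) + 1) - 2 * Real.sqrt (T : ℝ) := by
      rw [div_le_iff₀ h0]
      nlinarith [sq_nonneg (Real.sqrt ((T : ℝ) + 1) - Real.sqrt (T : ℝ))]
    linarith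

lemma Input.Valid.expectedRegret_le {A : Input 𝒴 N} {M : Model 𝒴 N} (hA : A.Valid M)
    (hρ : 0 < A.freq) (hη : 0 < A.threshold) (hc : 0 < A.cost) (hN : 2 ≤ N) (hT : 2 ≤ A.horizon)
    {h : ℕ → Fin N → 𝒴}
    (H : ∀ k, A.epochEnd k < A.horizon → ∀ i,
      M.Concentrated h (A.epochEnd k) (11 / 10 * A.ambiguity k) i (A.ref i)) :
    A.expectedRegret M h ≤ N * (A.warmLength +
      4 * A.cost / A.threshold * Real.sqrt (A.logFactor / A.freq) *
        (2 * Real.sqrt A.horizon)) := by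
  set K : ℝ := 4 * A.cost / A.threshold * Real.sqrt (A.logFactor / A.freq) with hK
  have hK0 : 0 ≤ K := by positivity
  calc A.expectedRegret M h
      ≤ ∑ t ∈ Finset.range A.horizon, ∑ _i : Fin N,
          ((if t < A.warmLength then 1 else 0) + K * (1 / Real.sqrt ((t : ℝ) + 1))) := by
        refine Finset.sum_le_sum fun t ht => Finset.sum_le_sum fun i _ => ?_
        exact hA.regret_rule_le hρ hη hc hN hT
          (fun k hk => H k (hk.trans_lt (Finset.mem_range.1 ht))) i
    _ = N * (((Finset.range A.horizon).filter fun t => t < A.warmLength).card +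
          K * ∑ t ∈ Finset.range A.horizon, 1 / Real.sqrt ((t : ℝ) + 1)) := by
        simp only [Finset.sum_const, Finset.card_univ, Fintype.card_fin, nsmul_eq_mul]
        rw [← Finset.mul_sum, Finset.sum_add_distrib, ← Finset.mul_sum, Finset.sum_boole]
    _ ≤ _ := by
        gcongr
        · calc ((Finset.range A.horizon).filter fun t => t < A.warmLength).card
              ≤ (Finset.range A.warmLength).card := Finset.card_le_card fun t ht => by
                simp only [Finset.mem_filter] at ht
                exact Finset.mem_range.2 ht.2
            _ = A.warmLength := Finset.card_range _
        · exact sum_one_div_sqrt_le A.horizon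

/-- Rational agents are honest in all rounds on the event of concentration: the rules of a round
depend on earlier reports only, so honesty propagates from round to round. -/
lemma Input.Valid.reports_eq {A : Input 𝒴 N} {M : Model 𝒴 N} (hA : A.Valid M)
    (hρ : 0 < A.freq) (hη : 0 < A.threshold) (hc : 0 < A.cost) (hN : 2 ≤ N) (hT : 2 ≤ A.horizon)
    {lo hi : ℝ} (hW : M.WarmStart A.cost lo hi) {x z : ℕ → Fin N → 𝒴}
    (hz : ∀ t < A.horizon, (∀ i, M.Truthful A.cost i (A.rule z t i)) → z t = x t)
    (H : ∀ k, A.epochEnd k < A.horizon → ∀ i,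
      M.Concentrated x (A.epochEnd k) (11 / 10 * A.ambiguity k) i (A.ref i)) :
    ∀ t < A.horizon, z t = x t := by
  intro t
  induction t using Nat.strong_induction_on with
  | _ t ih =>
    intro ht
    refine hz t ht (hA.truthful_rule hρ hη hc hN hT hW fun k hk i => ?_)
    exact (H k (hk.trans_lt ht) i).congr fun s hs =>
      (ih s (hs.trans_le hk) (by omega)).symm

/-- The regret bound with explicit constants: the length of the warm-start phase is `O(L)`,
`√L ≤ L`, and `L` is at most a multiple of `log (N log T / ε)` that depends on the number of labels
only, because `N log T / ε ≥ 2 log 2 > 1`. -/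
lemma Input.Valid.regret_bound_le {A : Input 𝒴 N} {M : Model 𝒴 N} (hA : A.Valid M)
    (hρ : 0 < A.freq) (hη : 0 < A.threshold) (hc : 0 < A.cost) (hN : 2 ≤ N)
    (hT : 2 ≤ A.horizon) :
    N * (A.warmLength + 4 * A.cost / A.threshold * Real.sqrt (A.logFactor / A.freq) *
        (2 * Real.sqrt A.horizon)) ≤
      (1 / (2 * A.freq * (min A.threshold (1 / Real.sqrt 2)) ^ 2) + 1 +
        8 * A.cost / (A.threshold * Real.sqrt A.freq)) *
        (4 * Real.log (((Fintype.card 𝒴 : ℝ) + 1) * 2 ^ Fintype.card 𝒴) + 1) *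
        (N * Real.sqrt A.horizon * Real.log (N * Real.log A.horizon / A.tol)) := by
  have hL1 := hA.le_logFactor hN hT
  have htol := hA.tol_pos
  have hN' : (2 : ℝ) ≤ N := by exact_mod_cast hN
  have hlog := log_horizon_gt hT
  have hm : 0 < min A.threshold (1 / Real.sqrt 2) := lt_min hη (by positivity)
  set m : ℝ := 2 * A.freq * (min A.threshold (1 / Real.sqrt 2)) ^ 2 with hmdef
  have hm0 : 0 < m := by positivity
  set D : ℝ := ((Fintype.card 𝒴 : ℝ) + 1) * 2 ^ Fintype.card 𝒴 with hD
  have hD1 : 1 ≤ D := by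
    have h1 : (1 : ℝ) ≤ 2 ^ Fintype.card 𝒴 := one_le_pow₀ (by norm_num)
    have h2 : (1 : ℝ) ≤ (Fintype.card 𝒴 : ℝ) + 1 := by simp
    rw [hD]
    nlinarith
  have hlogD : 0 ≤ Real.log D := Real.log_nonneg hD1
  set Λ : ℝ := Real.log (N * Real.log A.horizon / A.tol) with hΛ
  have harg : 1.386 ≤ N * Real.log A.horizon / A.tol := by
    rw [le_div_iff₀ htol]
    have h1 : 2 * 0.6931 ≤ N * Real.log A.horizon :=
      mul_le_mul hN' hlog.le (by norm_num) (by linarith)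
    nlinarith [hA.tol_lt]
  have hΛ4 : 1 / 4 ≤ Λ := by
    have h1 := Real.one_sub_inv_le_log_of_pos (by linarith : 0 < N * Real.log A.horizon / A.tol)
    have h2 : (N * Real.log A.horizon / A.tol)⁻¹ ≤ 3 / 4 :=
      inv_le_of_inv_le₀ (by norm_num) (by norm_num at harg ⊢; linarith)
    linarith
  have hLΛ : A.logFactor = Real.log D + Λ := by
    have h1 : ((Fintype.card 𝒴 : ℝ) + 1) * 2 ^ Fintype.card 𝒴 * N * Real.log A.horizon / A.tol =
        D * (N * Real.log A.horizon / A.tol) := by rw [hD]; ring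
    rw [Input.logFactor, h1, Real.log_mul (by positivity) (by linarith)]
  have hLle : A.logFactor ≤ (4 * Real.log D + 1) * Λ := by
    rw [hLΛ]
    nlinarith
  have hτ : (A.warmLength : ℝ) ≤ (1 / m + 1) * A.logFactor := by
    have h1 := (Nat.ceil_lt_add_one (by positivity : 0 ≤ A.logFactor / m)).le
    have h2 : (A.warmLength : ℝ) ≤ A.logFactor / m + 1 := h1
    have h3 : (1 / m + 1) * A.logFactor = A.logFactor / m + A.logFactor := by ring
    linarith
  have hsqrtL : Real.sqrt A.logFactor ≤ A.logFactor :=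
    Real.sqrt_le_iff.2 ⟨by linarith, by nlinarith⟩
  have hsqrtT : 1 ≤ Real.sqrt A.horizon :=
    Real.one_le_sqrt.2 (by exact_mod_cast (by omega : 1 ≤ A.horizon))
  have hsum : A.warmLength + 4 * A.cost / A.threshold * Real.sqrt (A.logFactor / A.freq) *
      (2 * Real.sqrt A.horizon) ≤
      (1 / m + 1 + 8 * A.cost / (A.threshold * Real.sqrt A.freq)) *
        (A.logFactor * Real.sqrt A.horizon) := by
    have h1 : (A.warmLength : ℝ) ≤ (1 / m + 1) * (A.logFactor * Real.sqrt A.horizon) := by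
      refine hτ.trans ?_
      have : A.logFactor ≤ A.logFactor * Real.sqrt A.horizon :=
        le_mul_of_one_le_right (by linarith) hsqrtT
      gcongr
    have h2 : 4 * A.cost / A.threshold * Real.sqrt (A.logFactor / A.freq) *
        (2 * Real.sqrt A.horizon) ≤ 8 * A.cost / (A.threshold * Real.sqrt A.freq) *
        (A.logFactor * Real.sqrt A.horizon) := by
      rw [Real.sqrt_div (by linarith)]
      calc _ = 8 * A.cost / (A.threshold * Real.sqrt A.freq) *
            (Real.sqrt A.logFactor * Real.sqrt A.horizon) := by
            field_simp
            ring
        _ ≤ _ := by gcongr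
    linarith
  calc N * (A.warmLength + 4 * A.cost / A.threshold * Real.sqrt (A.logFactor / A.freq) *
        (2 * Real.sqrt A.horizon))
      ≤ N * ((1 / m + 1 + 8 * A.cost / (A.threshold * Real.sqrt A.freq)) *
        (((4 * Real.log D + 1) * Λ) * Real.sqrt A.horizon)) := by
        refine mul_le_mul_of_nonneg_left (hsum.trans ?_) (by positivity)
        gcongr
    _ = _ := by ring

end Schedule

end DRAM

theorem mainTheorem1 {𝒴 : Type*} [Fintype 𝒴] [DecidableEq 𝒴] [MeasurableSpace 𝒴]
    [MeasurableSingletonClass 𝒴] (c ρ η : ℝ) (hc : 0 < c) (hρ : 0 < ρ) (hη : 0 < η) :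
    ∃ C : ℝ, 0 < C ∧ ∀ (N : ℕ) (M : DRAM.Model 𝒴 N) (A : DRAM.Input 𝒴 N) (lo hi : ℝ),
      2 ≤ N → 2 ≤ A.horizon →
      A.cost = c → A.freq = ρ → A.threshold = η →
      A.Valid M → M.WarmStart c lo hi →
      ∀ {Ω : Type*} [MeasurableSpace Ω] (P : Measure Ω) [IsProbabilityMeasure P]
        (Y : ℕ → Ω → 𝒴) (X Z : ℕ → Ω → Fin N → 𝒴),
        DRAM.IsSample M P Y X → (∀ t, Measurable (Z t)) → A.RationalReports M X Z →
        ENNReal.ofReal (1 - A.tol) ≤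
          P {ω |
            (∀ t < A.horizon, ∀ i : Fin N,
              M.Truthful c i (A.rule (fun s => Z s ω) t i) ∧ Z t ω i = X t ω i) ∧
            A.expectedRegret M (fun s => Z s ω) ≤
              C * (N * Real.sqrt A.horizon * Real.log (N * Real.log A.horizon / A.tol))} := by
  refine ⟨(1 / (2 * ρ * (min η (1 / Real.sqrt 2)) ^ 2) + 1 + 8 * c / (η * Real.sqrt ρ)) *
    (4 * Real.log (((Fintype.card 𝒴 : ℝ) + 1) * 2 ^ Fintype.card 𝒴) + 1), ?_, ?_⟩
  · have h1 : 0 ≤ Real.log (((Fintype.card 𝒴 : ℝ) + 1) * 2 ^ Fintype.card 𝒴) := by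
      exact_mod_cast Real.log_natCast_nonneg ((Fintype.card 𝒴 + 1) * 2 ^ Fintype.card 𝒴)
    positivity
  intro N M A lo hi hN hT hAc hAρ hAη hA hW Ω _ P _ Y X Z hX _ hZ
  subst hAc hAρ hAη
  have hbad := hX.measureReal_not_forall_concentrated_le hA hρ hη hN hT
  set bad : Set Ω := {ω | ¬ ∀ k, A.epochEnd k < A.horizon → ∀ i,
    M.Concentrated (fun t => X t ω) (A.epochEnd k) (11 / 10 * A.ambiguity k) i (A.ref i)}
    with hbadset
  -- the event of concentration is stated in terms of the observations `X`; subadditivity suffices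
  -- to bound the probability of its complement
  have hgood : 1 - A.tol ≤ P.real badᶜ := by
    have h1 : P.real Set.univ ≤ P.real bad + P.real badᶜ := by
      rw [← Set.union_compl_self bad]
      exact measureReal_union_le _ _
    rw [probReal_univ] at h1
    linarith
  refine (ENNReal.ofReal_le_ofReal hgood).trans ?_
  rw [ofReal_measureReal]
  refine measure_mono fun ω hω => ?_
  have H : ∀ k, A.epochEnd k < A.horizon → ∀ i,
      M.Concentrated (fun t => X t ω) (A.epochEnd k) (11 / 10 * A.ambiguity k) i (A.ref i) :=
    not_not.1 hω
  have hZX := hA.reports_eq (x := fun t => X t ω) (z := fun t => Z t ω) hρ hη hc hN hT hW (hZ ω) H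
  have HZ : ∀ k, A.epochEnd k < A.horizon → ∀ i,
      M.Concentrated (fun t => Z t ω) (A.epochEnd k) (11 / 10 * A.ambiguity k) i (A.ref i) :=
    fun k hk i => (H k hk i).congr fun s hs => (hZX s (hs.trans hk)).symm
  refine ⟨fun t ht i => ⟨?_, congrFun (hZX t ht) i⟩, ?_⟩
  · exact hA.truthful_rule hρ hη hc hN hT hW (fun k hk => HZ k (hk.trans_lt ht)) i
  · exact (hA.expectedRegret_le hρ hη hc hN hT HZ).trans (hA.regret_bound_le hρ hη hc hN hT)
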